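/- **Theorem.** Let $n\ge 3$ and $N_1,N_2\ge 0$ be integers. Let $$AQ_{-N_1}^{N_2}(2n)=\mathbb{C}\bigl[f^i[s],\,g_i[s] : 1\le i\le n,\ -N_1\le s\le N_2\bigr]\big/\bigl(r[-2N_1],\dots,r[2N_2]\bigr),$$ $$r[l]=\sum_{\substack{s+t=l\\ -N_1\le s,t\le N_2}}\ \sum_{i=1}^n f^i[s]\,g_i[t],$$ graded by the degree in the variables. Then the algebra $AQ_{-N_1}^{N_2}(2n)$ is Koszul, in the following sense. A graded commutative algebra $A=\bigoplus_{k\ge 0}A_k$ over $\mathbb{C}$ is *quadratic* if $A_0=\mathbb{C}$, the space $W=A_1$ is finite-dimensional, and the canonical map $T(W)\to A$ from the tensor algebra is surjective with kernel generated as a two-sided ideal by $R=\ker(W\otimes W\to A)$. Its quadratic dual is $A^!=T(W^*)/(R^\perp)$, where $R^\perp\subset W^*\otimes W^*$ is the orthogonal complement of $R$. Let $L=\bigoplus_{k\ge 1}L_k\subset A^!$ be the Lie sub-superalgebra (for the supercommutator, degree $k$ having parity $k \bmod 2$) generated by the odd space $L_1=W^*$; then $A^!$ is the universal enveloping algebra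 of $L$. For a homogeneous basis $b_\alpha$ of $L$, of parity $|\alpha|$, with $[b_\alpha,b_\beta]=\sum_\gamma f_{\alpha\beta}^\gamma b_\gamma$, the Chevalley–Eilenberg complex $C(L)$ is the free supercommutative algebra on the dual coordinates $c^\alpha$, of parity $|\alpha|+1$, with the odd derivation $d$ given by $$d c^\gamma=-\tfrac12\sum_{\alpha,\beta}(-1)^{|\alpha|(|\beta|+1)}f_{\alpha\beta}^\gamma\,c^\alpha c^\beta .$$ The algebra $A$ is *Koszul* if it is quadratic and its cohomology algebra $H(C(L))=\ker d/\operatorname{im} d$ is equal to $A$, that is, there is an isomorphism of algebras $A\cong H(C(L))$ that sends $w\in W=A_1$ to the class of $w$, regarded as a linear function on $L_1=W^*$. -/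

import Mathlib

open scoped TensorProduct DirectSum

noncomputable section

namespace QuasimapKoszul

/-- A Lie superalgebra over `ℂ` graded by `ℕ` with finite-dimensional components, the parity of an
element of degree `i` being `i` modulo `2`. The bracket of degree `i` and degree `j` takes values in
degree `k` whenever `i + j = k`. -/
structure GradedLieSuperalgebra where
  comp : ℕ → Type
  [addCommGroup : ∀ k, AddCommGroup (comp k)]
  [module : ∀ k, Module ℂ (comp k)]
  [finite : ∀ k, FiniteDimensional ℂ (comp k)]
  bracket : ∀ {i j k : ℕ}, i + j = k → comp i →ₗ[ℂ] comp j →ₗ[ℂ] comp k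
  skew : ∀ {i j k : ℕ} (h : i + j = k) (h' : j + i = k) (x : comp i) (y : comp j),
    bracket h x y = -((-1 : ℂ) ^ (i * j) • bracket h' y x)
  jacobi : ∀ {i j l ij jl il m : ℕ} (hij : i + j = ij) (hjl : j + l = jl) (hil : i + l = il)
    (h₁ : i + jl = m) (h₂ : ij + l = m) (h₃ : j + il = m) (x : comp i) (y : comp j) (z : comp l),
    bracket h₁ x (bracket hjl y z) =
      bracket h₂ (bracket hij x y) z + (-1 : ℂ) ^ (i * j) • bracket h₃ y (bracket hil x z)

attribute [instance] GradedLieSuperalgebra.addCommGroup GradedLieSuperalgebra.module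
  GradedLieSuperalgebra.finite

section ChevalleyEilenberg

variable (L : GradedLieSuperalgebra)

/-- The graded dual of `L`. -/
abbrev GradedDual : Type := ⨁ k, Module.Dual ℂ (L.comp k)

/-- A functional on the degree `k` component as a generator of the tensor algebra of the graded
dual. -/
def preGen (k : ℕ) : Module.Dual ℂ (L.comp k) →ₗ[ℂ] TensorAlgebra ℂ (GradedDual L) :=
  TensorAlgebra.ι ℂ ∘ₗ DirectSum.lof ℂ ℕ (fun k => Module.Dual ℂ (L.comp k)) k

/-- Supercommutativity: a functional on the degree `k` component has the reverse parity `k + 1`. -/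
inductive CERel : TensorAlgebra ℂ (GradedDual L) → TensorAlgebra ℂ (GradedDual L) → Prop
  | comm (i j : ℕ) (φ : Module.Dual ℂ (L.comp i)) (ψ : Module.Dual ℂ (L.comp j)) :
    CERel (preGen L i φ * preGen L j ψ)
      ((-1 : ℂ) ^ ((i + 1) * (j + 1)) • (preGen L j ψ * preGen L i φ))

/-- The free supercommutative algebra on the graded dual of `L` with reversed parity: polynomials
in the coordinates dual to a homogeneous basis, commuting for odd basis elements of `L` and
anticommuting for even ones. -/
def CEAlgebra : Type := RingQuot (CERel L)

instance : Ring (CEAlgebra L) := inferInstanceAs (Ring (RingQuot (CERel L)))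

instance : Algebra ℂ (CEAlgebra L) := inferInstanceAs (Algebra ℂ (RingQuot (CERel L)))

def ceMk : TensorAlgebra ℂ (GradedDual L) →ₐ[ℂ] CEAlgebra L := RingQuot.mkAlgHom ℂ (CERel L)

/-- The generator of the Chevalley-Eilenberg algebra given by a functional on the degree `k`
component. -/
def gen (k : ℕ) : Module.Dual ℂ (L.comp k) →ₗ[ℂ] CEAlgebra L := (ceMk L).toLinearMap ∘ₗ preGen L k

theorem gen_comm (i j : ℕ) (φ : Module.Dual ℂ (L.comp i)) (ψ : Module.Dual ℂ (L.comp j)) :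
    gen L i φ * gen L j ψ = (-1 : ℂ) ^ ((i + 1) * (j + 1)) • (gen L j ψ * gen L i φ) := by
  have := RingQuot.mkAlgHom_rel ℂ (CERel.comm (L := L) i j φ ψ)
  rw [map_mul, map_smul, map_mul] at this
  exact this

variable {L} in
/-- The algebra homomorphism with prescribed values on generators. -/
def ceLift {B : Type} [Ring B] [Algebra ℂ B] (f : ∀ k, Module.Dual ℂ (L.comp k) →ₗ[ℂ] B)
    (hf : ∀ i j (φ : Module.Dual ℂ (L.comp i)) (ψ : Module.Dual ℂ (L.comp j)),
      f i φ * f j ψ = (-1 : ℂ) ^ ((i + 1) * (j + 1)) • (f j ψ * f i φ)) : CEAlgebra L →ₐ[ℂ] B :=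
  RingQuot.liftAlgHom ℂ ⟨TensorAlgebra.lift ℂ (DirectSum.toModule ℂ ℕ B f), by
    rintro _ _ ⟨i, j, φ, ψ⟩
    simp [preGen, hf i j φ ψ]⟩

theorem ceLift_gen {B : Type} [Ring B] [Algebra ℂ B] (f : ∀ k, Module.Dual ℂ (L.comp k) →ₗ[ℂ] B)
    (hf) (k : ℕ) (φ : Module.Dual ℂ (L.comp k)) : ceLift f hf (gen L k φ) = f k φ := by
  refine (RingQuot.liftAlgHom_mkAlgHom_apply _ _ _ _).trans ?_
  simp [preGen]

variable {L} in
@[elab_as_elim]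
theorem ce_induction {P : CEAlgebra L → Prop} (algebraMap : ∀ r : ℂ, P (algebraMap ℂ _ r))
    (gen : ∀ k φ, P (gen L k φ)) (add : ∀ x y, P x → P y → P (x + y))
    (mul : ∀ x y, P x → P y → P (x * y)) (x : CEAlgebra L) : P x := by
  obtain ⟨t, rfl⟩ : ∃ t, ceMk L t = x := RingQuot.mkAlgHom_surjective ℂ (CERel L) x
  induction t using TensorAlgebra.induction with
  | algebraMap r => simpa using algebraMap r
  | ι v =>
    induction v using DirectSum.induction_on with
    | zero => simpa using algebraMap 0
    | of k φ => exact gen k φ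
    | add a b ha hb => simpa using add _ _ ha hb
  | mul a b ha hb => simpa using mul _ _ ha hb
  | add a b ha hb => simpa using add _ _ ha hb

/-- The parity automorphism. -/
def parity : CEAlgebra L →ₐ[ℂ] CEAlgebra L :=
  ceLift (fun k => (-1 : ℂ) ^ (k + 1) • gen L k) fun i j φ ψ => by
    simp only [LinearMap.smul_apply, smul_mul_smul_comm]
    rw [gen_comm, smul_comm, mul_comm ((-1 : ℂ) ^ (i + 1))]

theorem parity_gen (k : ℕ) (φ : Module.Dual ℂ (L.comp k)) :
    parity L (gen L k φ) = (-1 : ℂ) ^ (k + 1) • gen L k φ := ceLift_gen L _ _ k φ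

/-- The value of the differential on the coordinate `φ` of degree `k`. With dual homogeneous
bases `b α` and `c α` and structure constants `[b α, b β] = ∑ f α β γ • b γ`, it sends `c γ` to
`-1/2 ∑ (-1)^(|α| (|β| + 1)) f α β γ • c α * c β`. -/
def dGen (k : ℕ) : Module.Dual ℂ (L.comp k) →ₗ[ℂ] CEAlgebra L :=
  -(1 / 2 : ℂ) • ∑ p : Finset.HasAntidiagonal.antidiagonal k,
    ∑ a, ∑ b, (-1 : ℂ) ^ (p.1.1 * (p.1.2 + 1)) •
      (Module.Dual.eval ℂ (L.comp k)
        (L.bracket (Finset.HasAntidiagonal.mem_antidiagonal.1 p.2) (Module.finBasis ℂ (L.comp p.1.1) a)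
          (Module.finBasis ℂ (L.comp p.1.2) b))).smulRight
        (gen L p.1.1 ((Module.finBasis ℂ (L.comp p.1.1)).coord a) *
          gen L p.1.2 ((Module.finBasis ℂ (L.comp p.1.2)).coord b))

theorem gen_gen_comm (i j k : ℕ) (φ : Module.Dual ℂ (L.comp i)) (ψ : Module.Dual ℂ (L.comp j))
    (χ : Module.Dual ℂ (L.comp k)) :
    gen L i φ * gen L j ψ * gen L k χ =
      (-1 : ℂ) ^ ((i + j) * (k + 1)) • (gen L k χ * (gen L i φ * gen L j ψ)) := by
  rw [mul_assoc, gen_comm L j k, mul_smul_comm, ← mul_assoc, gen_comm L i k, smul_mul_assoc,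
    smul_smul, mul_assoc, ← pow_add]
  congr 1
  rw [show (j + 1) * (k + 1) + (i + 1) * (k + 1) = (i + j) * (k + 1) + 2 * (k + 1) by ring,
    pow_add, pow_mul _ 2]
  simp

theorem dGen_comm (i j : ℕ) (φ : Module.Dual ℂ (L.comp i)) (ψ : Module.Dual ℂ (L.comp j)) :
    dGen L i φ * gen L j ψ = (-1 : ℂ) ^ (i * (j + 1)) • (gen L j ψ * dGen L i φ) := by
  simp only [dGen, LinearMap.smul_apply, LinearMap.sum_apply, LinearMap.smulRight_apply,
    smul_mul_assoc, mul_smul_comm, Finset.sum_mul, Finset.mul_sum, Finset.smul_sum]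
  refine Finset.sum_congr rfl fun p _ => Finset.sum_congr rfl fun a _ =>
    Finset.sum_congr rfl fun b _ => ?_
  rw [gen_gen_comm, Finset.HasAntidiagonal.mem_antidiagonal.1 p.2]
  simp only [smul_smul]
  congr 1
  ring

/-- The homomorphism `x ↦ [[parity x, d x], [0, x]]`, which encodes the odd derivation `d`. -/
def dHom : CEAlgebra L →ₐ[ℂ] Matrix (Fin 2) (Fin 2) (CEAlgebra L) :=
  ceLift (fun k =>
    { toFun := fun φ => !![parity L (gen L k φ), dGen L k φ; 0, gen L k φ]
      map_add' := fun φ ψ => by ext a b; fin_cases a <;> fin_cases b <;> simp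
      map_smul' := fun c φ => by ext a b; fin_cases a <;> fin_cases b <;> simp }) fun i j φ ψ => by
    simp only [LinearMap.coe_mk, AddHom.coe_mk, Matrix.mul_fin_two, mul_zero, zero_mul, add_zero,
      zero_add]
    have e : parity L (gen L i φ) * dGen L j ψ + dGen L i φ * gen L j ψ =
        (-1 : ℂ) ^ ((i + 1) * (j + 1)) •
          (parity L (gen L j ψ) * dGen L i φ + dGen L j ψ * gen L i φ) := by
      rw [dGen_comm, dGen_comm, parity_gen, parity_gen]
      simp only [smul_mul_assoc, smul_add, smul_smul, ← pow_add]
      rw [add_comm]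
      congr 2
      · rw [show (i + 1) * (j + 1) + (j + 1) = i * (j + 1) + 2 * (j + 1) by ring, pow_add,
          pow_mul _ 2]
        simp
      · rw [show (i + 1) * (j + 1) + j * (i + 1) = (i + 1) + 2 * (j * (i + 1)) by ring,
          pow_add _ (i + 1), pow_mul _ 2]
        simp
    ext a b
    fin_cases a <;> fin_cases b
    · simpa using congrArg (parity L) (gen_comm L i j φ ψ)
    · simpa using e
    · simp
    · simpa using gen_comm L i j φ ψ

theorem dHom_gen (k : ℕ) (φ : Module.Dual ℂ (L.comp k)) :
    dHom L (gen L k φ) = !![parity L (gen L k φ), dGen L k φ; 0, gen L k φ] :=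
  ceLift_gen L _ _ k φ

/-- The Chevalley-Eilenberg differential. -/
def d : CEAlgebra L →ₗ[ℂ] CEAlgebra L :=
  Matrix.entryLinearMap ℂ (CEAlgebra L) (0 : Fin 2) (1 : Fin 2) ∘ₗ (dHom L).toLinearMap

theorem d_apply (x : CEAlgebra L) : d L x = dHom L x 0 1 := rfl

theorem dHom_apply (x : CEAlgebra L) : dHom L x = !![parity L x, d L x; 0, x] := by
  suffices h : dHom L x 0 0 = parity L x ∧ dHom L x 1 0 = 0 ∧ dHom L x 1 1 = x by
    ext a b
    fin_cases a <;> fin_cases b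
    · simpa using h.1
    · simp [d_apply]
    · simpa using h.2.1
    · simpa using h.2.2
  induction x using ce_induction with
  | algebraMap r => simp [AlgHom.commutes, Matrix.algebraMap_matrix_apply]
  | gen k φ => simp [dHom_gen]
  | add x y hx hy => simp [hx, hy]
  | mul x y hx hy => simp [Matrix.mul_apply, hx, hy]

theorem d_gen (k : ℕ) (φ : Module.Dual ℂ (L.comp k)) : d L (gen L k φ) = dGen L k φ := by
  simp [d_apply, dHom_gen]

theorem d_algebraMap (r : ℂ) : d L (algebraMap ℂ _ r) = 0 := by
  simp [d_apply, AlgHom.commutes, Matrix.algebraMap_matrix_apply]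

/-- The differential is an odd derivation. -/
theorem d_mul (x y : CEAlgebra L) : d L (x * y) = d L x * y + parity L x * d L y := by
  have h : dHom L (x * y) 0 1 = (dHom L x * dHom L y) 0 1 := by rw [map_mul]
  rw [dHom_apply, dHom_apply, dHom_apply] at h
  simpa [Matrix.mul_apply, add_comm] using h

theorem parity_dGen (k : ℕ) (φ : Module.Dual ℂ (L.comp k)) :
    parity L (dGen L k φ) = (-1 : ℂ) ^ k • dGen L k φ := by
  simp only [dGen, LinearMap.smul_apply, LinearMap.sum_apply, LinearMap.smulRight_apply,
    map_smul, map_sum, Finset.smul_sum, map_mul, parity_gen, smul_mul_smul_comm]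
  refine Finset.sum_congr rfl fun p _ => Finset.sum_congr rfl fun a _ =>
    Finset.sum_congr rfl fun b _ => ?_
  rw [← pow_add, show p.1.1 + 1 + (p.1.2 + 1) = k + 2 by
    have := Finset.HasAntidiagonal.mem_antidiagonal.1 p.2; omega]
  simp only [smul_smul]
  congr 1
  ring

theorem parity_parity (x : CEAlgebra L) : parity L (parity L x) = x := by
  induction x using ce_induction with
  | algebraMap r => simp
  | gen k φ => simp [parity_gen, smul_smul, ← mul_pow]
  | add x y hx hy => simp [hx, hy]
  | mul x y hx hy => simp [hx, hy]

theorem d_parity (x : CEAlgebra L) : d L (parity L x) = -parity L (d L x) := by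
  induction x using ce_induction with
  | algebraMap r => simp [d_algebraMap]
  | gen k φ => simp [parity_gen, d_gen, parity_dGen, pow_succ]
  | add x y hx hy => simp [hx, hy, add_comm]
  | mul x y hx hy => simp [hx, hy, d_mul, add_comm]

theorem dGen_apply (k : ℕ) (φ : Module.Dual ℂ (L.comp k)) :
    dGen L k φ = -(1 / 2 : ℂ) • ∑ p : Finset.HasAntidiagonal.antidiagonal k,
      ∑ a, ∑ b, (-1 : ℂ) ^ (p.1.1 * (p.1.2 + 1)) •
        φ (L.bracket (Finset.HasAntidiagonal.mem_antidiagonal.1 p.2)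
          (Module.finBasis ℂ (L.comp p.1.1) a) (Module.finBasis ℂ (L.comp p.1.2) b)) •
        (gen L p.1.1 ((Module.finBasis ℂ (L.comp p.1.1)).coord a) *
          gen L p.1.2 ((Module.finBasis ℂ (L.comp p.1.2)).coord b)) := by
  simp [dGen]

theorem sum_antidiagonal_dite {M : Type} [AddCommMonoid M] {k N : ℕ} (hk : k < N)
    (G : ∀ i j, i + j = k → M) :
    ∑ p : Finset.HasAntidiagonal.antidiagonal k,
        G p.1.1 p.1.2 (Finset.HasAntidiagonal.mem_antidiagonal.1 p.2) =
      ∑ i ∈ Finset.range N, ∑ j ∈ Finset.range N, if h : i + j = k then G i j h else 0 := by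
  have e : ∀ p : Finset.HasAntidiagonal.antidiagonal k,
      G p.1.1 p.1.2 (Finset.HasAntidiagonal.mem_antidiagonal.1 p.2) =
        (fun p : ℕ × ℕ => if h : p.1 + p.2 = k then G p.1 p.2 h else 0) p.1 := fun p => by
    have := Finset.HasAntidiagonal.mem_antidiagonal.1 p.2
    simp [this]
  rw [Finset.sum_congr rfl fun p _ => e p, Finset.sum_coe_sort _
    (fun p : ℕ × ℕ => if h : p.1 + p.2 = k then G p.1 p.2 h else 0), ← Finset.sum_product']
  refine Finset.sum_subset (fun p hp => ?_) fun p _ hp => ?_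
  · have := Finset.HasAntidiagonal.mem_antidiagonal.1 hp
    simp only [Finset.mem_product, Finset.mem_range]
    omega
  · rw [Finset.HasAntidiagonal.mem_antidiagonal] at hp
    simp [hp]

theorem sum_apply_smul_dGen (k : ℕ) (ψ : Module.Dual ℂ (L.comp k)) :
    ∑ a, ψ (Module.finBasis ℂ (L.comp k) a) • dGen L k ((Module.finBasis ℂ (L.comp k)).coord a) =
      dGen L k ψ := by
  rw [← Module.Basis.sum_dual_apply_smul_coord (Module.finBasis ℂ (L.comp k)) ψ, map_sum]
  simp

/-- One half of `d (d φ)`, up to a scalar. -/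
theorem d_dGen_aux (k : ℕ) (φ : Module.Dual ℂ (L.comp k)) :
    d L (dGen L k φ) = -∑ i ∈ Finset.range (k + 1), ∑ j ∈ Finset.range (k + 1),
      if h : i + j = k then ∑ b, (-1 : ℂ) ^ (i * (j + 1)) •
        (dGen L i (φ ∘ₗ (L.bracket h).flip (Module.finBasis ℂ (L.comp j) b)) *
          gen L j ((Module.finBasis ℂ (L.comp j)).coord b)) else 0 := by
  set X := ∑ i ∈ Finset.range (k + 1), ∑ j ∈ Finset.range (k + 1),
      if h : i + j = k then ∑ b, (-1 : ℂ) ^ (i * (j + 1)) •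
        (dGen L i (φ ∘ₗ (L.bracket h).flip (Module.finBasis ℂ (L.comp j) b)) *
          gen L j ((Module.finBasis ℂ (L.comp j)).coord b)) else 0 with hX
  rw [dGen_apply, sum_antidiagonal_dite (Nat.lt_succ_self k) (fun i j h =>
    ∑ a, ∑ b, (-1 : ℂ) ^ (i * (j + 1)) •
        φ (L.bracket h (Module.finBasis ℂ (L.comp i) a) (Module.finBasis ℂ (L.comp j) b)) •
        (gen L i ((Module.finBasis ℂ (L.comp i)).coord a) *
          gen L j ((Module.finBasis ℂ (L.comp j)).coord b)))]
  have key : ∀ i j, d L (if h : i + j = k then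
      ∑ a, ∑ b, (-1 : ℂ) ^ (i * (j + 1)) •
        φ (L.bracket h (Module.finBasis ℂ (L.comp i) a) (Module.finBasis ℂ (L.comp j) b)) •
        (gen L i ((Module.finBasis ℂ (L.comp i)).coord a) *
          gen L j ((Module.finBasis ℂ (L.comp j)).coord b)) else 0) =
      (if h : i + j = k then ∑ b, (-1 : ℂ) ^ (i * (j + 1)) •
        (dGen L i (φ ∘ₗ (L.bracket h).flip (Module.finBasis ℂ (L.comp j) b)) *
          gen L j ((Module.finBasis ℂ (L.comp j)).coord b)) else 0) +
      (if h : j + i = k then ∑ b, (-1 : ℂ) ^ (j * (i + 1)) •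
        (dGen L j (φ ∘ₗ (L.bracket h).flip (Module.finBasis ℂ (L.comp i) b)) *
          gen L i ((Module.finBasis ℂ (L.comp i)).coord b)) else 0) := by
    intro i j
    by_cases h : i + j = k
    swap
    · have h' : ¬ j + i = k := by omega
      simp [h, h']
    have h' : j + i = k := by omega
    simp only [h, h', dite_true, map_sum, map_smul, d_mul, d_gen, parity_gen, smul_add,
      Finset.sum_add_distrib]
    congr 1
    · rw [Finset.sum_comm]
      refine Finset.sum_congr rfl fun b _ => ?_
      rw [← sum_apply_smul_dGen, Finset.sum_mul, Finset.smul_sum]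
      refine Finset.sum_congr rfl fun a _ => ?_
      simp
    · refine Finset.sum_congr rfl fun a _ => ?_
      rw [← sum_apply_smul_dGen, Finset.sum_mul, Finset.smul_sum]
      refine Finset.sum_congr rfl fun b _ => ?_
      simp only [LinearMap.comp_apply, LinearMap.flip_apply]
      rw [smul_mul_assoc, smul_mul_assoc, dGen_comm, L.skew h h']
      simp only [map_neg, map_smul, smul_smul, smul_eq_mul, neg_mul, mul_neg]
      congr 1
      have h1 : ((-1 : ℂ) ^ (i * j)) * ((-1 : ℂ) ^ (i * j)) = 1 := by
        rw [← mul_pow]; simp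
      have h2 : ((-1 : ℂ) ^ i) * ((-1 : ℂ) ^ i) = 1 := by rw [← mul_pow]; simp
      have h3 : ((-1 : ℂ) ^ j) * ((-1 : ℂ) ^ j) = 1 := by rw [← mul_pow]; simp
      simp only [mul_add, mul_one, pow_add, pow_one, mul_comm j i]
      linear_combination
        (φ ((L.bracket h' (Module.finBasis ℂ (L.comp j) b)) (Module.finBasis ℂ (L.comp i) a))) *
        ((-1) ^ (i * j) * (-1) ^ (i * j) * (h2 - h3))
  simp only [map_smul, map_sum, key, Finset.sum_add_distrib]
  rw [Finset.sum_comm (s := Finset.range (k + 1)) (t := Finset.range (k + 1))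
    (f := fun i j => if h : j + i = k then ∑ b, (-1 : ℂ) ^ (j * (i + 1)) •
        (dGen L j (φ ∘ₗ (L.bracket h).flip (Module.finBasis ℂ (L.comp i) b)) *
          gen L i ((Module.finBasis ℂ (L.comp i)).coord b)) else 0), ← hX, ← two_smul ℂ X, smul_smul]
  norm_num

/-- The summand of degree `(p, q, r)` in `d (d φ)`. -/
def tripleTerm (k : ℕ) (φ : Module.Dual ℂ (L.comp k)) (p q r : ℕ) : CEAlgebra L :=
  if h : p + q + r = k then ∑ a, ∑ b, ∑ c,
    ((-1 : ℂ) ^ ((p + q) * (r + 1) + p * (q + 1)) *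
      φ (L.bracket h (L.bracket rfl (Module.finBasis ℂ (L.comp p) a)
        (Module.finBasis ℂ (L.comp q) b)) (Module.finBasis ℂ (L.comp r) c))) •
      (gen L p ((Module.finBasis ℂ (L.comp p)).coord a) *
        gen L q ((Module.finBasis ℂ (L.comp q)).coord b) *
        gen L r ((Module.finBasis ℂ (L.comp r)).coord c)) else 0

theorem neg_one_pow_mul_self (m : ℕ) : (-1 : ℂ) ^ m * (-1 : ℂ) ^ m = 1 := by
  rw [← mul_pow]; simp

theorem jacobi_cyclic {p q r pq qr rp k : ℕ} (hpq : p + q = pq) (hqr : q + r = qr)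
    (hrp : r + p = rp) (h₁ : pq + r = k) (h₂ : qr + p = k) (h₃ : rp + q = k)
    (x : L.comp p) (y : L.comp q) (z : L.comp r) :
    L.bracket h₁ (L.bracket hpq x y) z
      + (-1 : ℂ) ^ (p * (q + r)) • L.bracket h₂ (L.bracket hqr y z) x
      + (-1 : ℂ) ^ (r * (p + q)) • L.bracket h₃ (L.bracket hrp z x) y = 0 := by
  have e := L.jacobi hpq hqr (show p + r = rp by omega) (show p + qr = k by omega) h₁
    (show q + rp = k by omega) x y z
  rw [L.skew h₂ (show p + qr = k by omega), L.skew h₃ (show q + rp = k by omega),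
    L.skew hrp (show p + r = rp by omega), e]
  subst hqr hrp
  simp only [map_neg, map_smul, smul_neg, neg_neg, smul_smul]
  have h1 := neg_one_pow_mul_self (p * (q + r))
  have h2 : (-1 : ℂ) ^ (r * (p + q)) * ((-1) ^ ((r + p) * q) * (-1) ^ (r * p)) =
      (-1) ^ (p * q) := by
    rw [← pow_add, ← pow_add, show r * (p + q) + ((r + p) * q + r * p) =
      p * q + 2 * (r * p + r * q) by ring, pow_add, pow_mul _ 2]
    simp
  have h3 : (-1 : ℂ) ^ (p * (q + r)) * (-1) ^ ((q + r) * p) = 1 := by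
    rw [mul_comm (q + r) p]; exact h1
  rw [h2, h3]
  module

theorem gen_cycle (p q r : ℕ) (φ : Module.Dual ℂ (L.comp p)) (ψ : Module.Dual ℂ (L.comp q))
    (χ : Module.Dual ℂ (L.comp r)) : gen L q ψ * gen L r χ * gen L p φ =
      (-1 : ℂ) ^ ((q + r) * (p + 1)) • (gen L p φ * gen L q ψ * gen L r χ) := by
  rw [gen_gen_comm, mul_assoc (gen L p φ)]

theorem tripleTerm_cyclic (k : ℕ) (φ : Module.Dual ℂ (L.comp k)) (p q r : ℕ) :
    tripleTerm L k φ p q r + tripleTerm L k φ q r p + tripleTerm L k φ r p q = 0 := by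
  by_cases h : p + q + r = k
  swap
  · have h₂ : ¬ q + r + p = k := by omega
    have h₃ : ¬ r + p + q = k := by omega
    simp [tripleTerm, h, h₂, h₃]
  have h₂ : q + r + p = k := by omega
  have h₃ : r + p + q = k := by omega
  simp only [tripleTerm, h, h₂, h₃, dite_true]
  rw [Finset.sum_comm_cycle (s := (Finset.univ : Finset (Fin (Module.finrank ℂ (L.comp q)))))]
  refine (congrArg₂ (· + ·) rfl Finset.sum_comm_cycle.symm).trans ?_
  simp only [← Finset.sum_add_distrib]
  refine Finset.sum_eq_zero fun a _ => Finset.sum_eq_zero fun b _ => Finset.sum_eq_zero fun c _ => ?_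
  set x := Module.finBasis ℂ (L.comp p) a
  set y := Module.finBasis ℂ (L.comp q) b
  set z := Module.finBasis ℂ (L.comp r) c
  have e3 : gen L r ((Module.finBasis ℂ (L.comp r)).coord c) *
      gen L p ((Module.finBasis ℂ (L.comp p)).coord a) *
      gen L q ((Module.finBasis ℂ (L.comp q)).coord b) = (-1 : ℂ) ^ ((p + q) * (r + 1)) •
      (gen L p ((Module.finBasis ℂ (L.comp p)).coord a) *
      gen L q ((Module.finBasis ℂ (L.comp q)).coord b) *
      gen L r ((Module.finBasis ℂ (L.comp r)).coord c)) := by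
    rw [gen_cycle L r p q, smul_smul, neg_one_pow_mul_self, one_smul]
  rw [gen_cycle L p q r, e3, smul_smul, smul_smul, ← add_smul, ← add_smul]
  have J := congrArg φ (jacobi_cyclic L rfl rfl rfl h h₂ h₃ x y z)
  simp only [map_add, map_smul, map_zero, smul_eq_mul] at J
  convert zero_smul ℂ _
  have hp := neg_one_pow_mul_self p
  have hq := neg_one_pow_mul_self q
  have hr := neg_one_pow_mul_self r
  have hpq := neg_one_pow_mul_self (p * q)
  have hqr := neg_one_pow_mul_self (q * r)
  have hpr := neg_one_pow_mul_self (p * r)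
  have s1 : (-1 : ℂ) ^ ((p + q) * (r + 1) + p * (q + 1)) =
      (-1) ^ (p * q + q * r + p * r + q) := by
    rw [show (p + q) * (r + 1) + p * (q + 1) = (p * q + q * r + p * r + q) + 2 * p by ring,
      pow_add _ (p * q + q * r + p * r + q), pow_mul _ 2]
    simp
  have s2 : (-1 : ℂ) ^ ((q + r) * (p + 1) + q * (r + 1)) * (-1) ^ ((q + r) * (p + 1)) =
      (-1) ^ (p * q + q * r + p * r + q) * (-1) ^ (p * (q + r)) := by
    rw [← pow_add, ← pow_add, show (q + r) * (p + 1) + q * (r + 1) + (q + r) * (p + 1) =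
      (q * r + q) + 2 * ((q + r) * (p + 1)) by ring,
      show p * q + q * r + p * r + q + p * (q + r) = (q * r + q) + 2 * (p * q + p * r) by ring,
      pow_add _ (q * r + q), pow_add _ (q * r + q), pow_mul _ 2, pow_mul _ 2]
    simp
  have s3 : (-1 : ℂ) ^ ((r + p) * (q + 1) + r * (p + 1)) * (-1) ^ ((p + q) * (r + 1)) =
      (-1) ^ (p * q + q * r + p * r + q) * (-1) ^ (r * (p + q)) := by
    rw [← pow_add, ← pow_add, show (r + p) * (q + 1) + r * (p + 1) + (p + q) * (r + 1) =
      (p * q + q) + 2 * (q * r + p * r + r + p) by ring,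
      show p * q + q * r + p * r + q + r * (p + q) = (p * q + q) + 2 * (q * r + p * r) by ring,
      pow_add _ (p * q + q), pow_add _ (p * q + q), pow_mul _ 2, pow_mul _ 2]
    simp
  linear_combination (-1 : ℂ) ^ (p * q + q * r + p * r + q) * J +
    φ (L.bracket h (L.bracket rfl x y) z) * s1 + φ (L.bracket h₂ (L.bracket rfl y z) x) * s2 +
    φ (L.bracket h₃ (L.bracket rfl z x) y) * s3

theorem d_dGen (k : ℕ) (φ : Module.Dual ℂ (L.comp k)) : d L (dGen L k φ) = 0 := by
  set N := k + 1 with hN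
  have hS : d L (dGen L k φ) = (1 / 2 : ℂ) • ∑ r ∈ Finset.range N, ∑ p ∈ Finset.range N,
      ∑ q ∈ Finset.range N, tripleTerm L k φ p q r := by
    rw [d_dGen_aux, Finset.sum_comm, Finset.smul_sum, ← Finset.sum_neg_distrib]
    refine Finset.sum_congr rfl fun r hr => ?_
    have e1 : ∀ i ∈ Finset.range N, (if h : i + r = k then ∑ c, (-1 : ℂ) ^ (i * (r + 1)) •
        (dGen L i (φ ∘ₗ (L.bracket h).flip (Module.finBasis ℂ (L.comp r) c)) *
          gen L r ((Module.finBasis ℂ (L.comp r)).coord c)) else 0) =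
        -(1 / 2 : ℂ) • ∑ p ∈ Finset.range N, ∑ q ∈ Finset.range N,
          if p + q = i then tripleTerm L k φ p q r else 0 := by
      intro i hi
      by_cases h : i + r = k
      swap
      · rw [dif_neg h]
        symm
        rw [Finset.sum_eq_zero, smul_zero]
        refine fun p _ => Finset.sum_eq_zero fun q _ => ?_
        split_ifs with h'
        · subst h'
          simp [tripleTerm, h]
        · rfl
      rw [dif_pos h]
      have e2 : ∀ c, dGen L i (φ ∘ₗ (L.bracket h).flip (Module.finBasis ℂ (L.comp r) c)) =
          -(1 / 2 : ℂ) • ∑ p ∈ Finset.range N, ∑ q ∈ Finset.range N,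
            if hpq : p + q = i then ∑ a, ∑ b, (-1 : ℂ) ^ (p * (q + 1)) •
              φ (L.bracket h (L.bracket hpq (Module.finBasis ℂ (L.comp p) a)
                (Module.finBasis ℂ (L.comp q) b)) (Module.finBasis ℂ (L.comp r) c)) •
              (gen L p ((Module.finBasis ℂ (L.comp p)).coord a) *
                gen L q ((Module.finBasis ℂ (L.comp q)).coord b)) else 0 := by
        intro c
        rw [dGen_apply]
        congr 1
        exact sum_antidiagonal_dite (Finset.mem_range.1 hi) (fun p q hpq =>
          ∑ a, ∑ b, (-1 : ℂ) ^ (p * (q + 1)) •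
              φ (L.bracket h (L.bracket hpq (Module.finBasis ℂ (L.comp p) a)
                (Module.finBasis ℂ (L.comp q) b)) (Module.finBasis ℂ (L.comp r) c)) •
              (gen L p ((Module.finBasis ℂ (L.comp p)).coord a) *
                gen L q ((Module.finBasis ℂ (L.comp q)).coord b)))
      simp only [e2, smul_mul_assoc, Finset.sum_mul, smul_comm _ (-(1 / 2) : ℂ), ← Finset.smul_sum]
      congr 1
      simp only [Finset.smul_sum]
      rw [Finset.sum_comm]
      refine Finset.sum_congr rfl fun p _ => ?_
      rw [Finset.sum_comm]
      refine Finset.sum_congr rfl fun q _ => ?_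
      by_cases hpq : p + q = i
      swap
      · simp [hpq]
      subst hpq
      simp only [dite_true, if_true, tripleTerm, h]
      refine Eq.trans ?_ Finset.sum_comm_cycle.symm
      refine Finset.sum_congr rfl fun c _ => ?_
      rw [Finset.sum_mul, Finset.smul_sum]
      refine Finset.sum_congr rfl fun a _ => ?_
      rw [Finset.sum_mul, Finset.smul_sum]
      refine Finset.sum_congr rfl fun b _ => ?_
      simp only [smul_mul_assoc, smul_smul, pow_add, mul_assoc]
    rw [Finset.sum_congr rfl e1, ← Finset.smul_sum, ← neg_smul, neg_neg]
    congr 1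
    rw [Finset.sum_comm]
    refine Finset.sum_congr rfl fun p _ => ?_
    rw [Finset.sum_comm]
    refine Finset.sum_congr rfl fun q _ => ?_
    rw [Finset.sum_ite_eq]
    split_ifs with h
    · rfl
    · have : ¬ p + q + r = k := by
        rw [Finset.mem_range] at h; omega
      simp [tripleTerm, this]
  set S := ∑ r ∈ Finset.range N, ∑ p ∈ Finset.range N,
      ∑ q ∈ Finset.range N, tripleTerm L k φ p q r with hSdef
  have c1 : S = ∑ p ∈ Finset.range N, ∑ q ∈ Finset.range N,
      ∑ r ∈ Finset.range N, tripleTerm L k φ p q r := Finset.sum_comm_cycle.symm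
  have h3 : S + S + S = 0 := by
    have e : ∑ p ∈ Finset.range N, ∑ q ∈ Finset.range N, ∑ r ∈ Finset.range N,
      (tripleTerm L k φ p q r + tripleTerm L k φ q r p + tripleTerm L k φ r p q) = 0 :=
      Finset.sum_eq_zero fun p _ => Finset.sum_eq_zero fun q _ => Finset.sum_eq_zero fun r _ =>
        tripleTerm_cyclic L k φ p q r
    simp only [Finset.sum_add_distrib] at e
    rw [← c1, ← hSdef] at e
    have c2 : S = ∑ p ∈ Finset.range N, ∑ q ∈ Finset.range N,
      ∑ r ∈ Finset.range N, tripleTerm L k φ r p q := c1.trans Finset.sum_comm_cycle.symm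
    rwa [← c2] at e
  have h4 : (3 : ℂ) • S = 0 := by rw [← h3]; module
  rw [hS, (smul_eq_zero.1 h4).resolve_left (by norm_num), smul_zero]

theorem d_d (x : CEAlgebra L) : d L (d L x) = 0 := by
  induction x using ce_induction with
  | algebraMap r => simp [d_algebraMap]
  | gen k φ => rw [d_gen, d_dGen]
  | add x y hx hy => simp [hx, hy]
  | mul x y hx hy => simp [hx, hy, d_mul, d_parity, parity_parity]

/-- The cocycles of the Chevalley-Eilenberg complex. -/
def cocycles : Subalgebra ℂ (CEAlgebra L) where
  carrier := {x | d L x = 0}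
  mul_mem' {x y} (hx : d L x = 0) (hy : d L y = 0) := by simp [d_mul, hx, hy]
  add_mem' {x y} (hx : d L x = 0) (hy : d L y = 0) := by simp [hx, hy]
  algebraMap_mem' r := d_algebraMap L r

theorem mem_cocycles {x : CEAlgebra L} : x ∈ cocycles L ↔ d L x = 0 := Iff.rfl

/-- The ideal of coboundaries in the algebra of cocycles. -/
def coboundaries : Ideal (cocycles L) where
  carrier := {z | ∃ w, d L w = z}
  add_mem' := by
    rintro x y ⟨v, hv⟩ ⟨w, hw⟩
    exact ⟨v + w, by simp [hv, hw]⟩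
  zero_mem' := ⟨0, by simp⟩
  smul_mem' := by
    rintro z x ⟨w, hw⟩
    have hz := (mem_cocycles L).1 z.2
    exact ⟨parity L z * w, by simp [d_mul, d_parity, hz, parity_parity, hw]⟩

instance : (coboundaries L).IsTwoSided where
  mul_mem_of_left {x} z := by
    rintro ⟨w, hw⟩
    have hz := (mem_cocycles L).1 z.2
    exact ⟨w * z, by simp [d_mul, hz, hw]⟩

/-- The cohomology algebra of the Chevalley-Eilenberg complex. -/
abbrev Cohomology : Type := cocycles L ⧸ coboundaries L

end ChevalleyEilenberg

section QuadraticDual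

variable {W : Type} [AddCommGroup W] [Module ℂ W] (R : Submodule ℂ (W ⊗[ℂ] W))

/-- The orthogonal complement of a space of quadratic relations. -/
def orthogonalRelations : Submodule ℂ (Module.Dual ℂ W ⊗[ℂ] Module.Dual ℂ W) where
  carrier := {η | ∀ r ∈ R, TensorProduct.dualDistrib ℂ W W η r = 0}
  zero_mem' := by simp
  add_mem' ha hb r hr := by simp [ha r hr, hb r hr]
  smul_mem' c a ha r hr := by simp [ha r hr]

/-- The inclusion of `M ⊗ M` into the tensor algebra of `M`. -/
def tensorSquare (M : Type) [AddCommGroup M] [Module ℂ M] : M ⊗[ℂ] M →ₗ[ℂ] TensorAlgebra ℂ M :=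
  TensorProduct.lift
    ((LinearMap.mul ℂ (TensorAlgebra ℂ M)).compl₁₂ (TensorAlgebra.ι ℂ) (TensorAlgebra.ι ℂ))

inductive DualRel : TensorAlgebra ℂ (Module.Dual ℂ W) → TensorAlgebra ℂ (Module.Dual ℂ W) → Prop
  | of (η : Module.Dual ℂ W ⊗[ℂ] Module.Dual ℂ W) (h : η ∈ orthogonalRelations R) :
    DualRel (tensorSquare (Module.Dual ℂ W) η) 0

/-- The dual of the quadratic algebra with generators `W` and relations `R`: the tensor algebra of
the dual space of `W` modulo the ideal generated by the orthogonal complement of `R`. -/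
def QuadraticDual : Type := RingQuot (DualRel R)

instance : Ring (QuadraticDual R) := inferInstanceAs (Ring (RingQuot (DualRel R)))

instance : Algebra ℂ (QuadraticDual R) := inferInstanceAs (Algebra ℂ (RingQuot (DualRel R)))

def dualMk : TensorAlgebra ℂ (Module.Dual ℂ W) →ₐ[ℂ] QuadraticDual R :=
  RingQuot.mkAlgHom ℂ (DualRel R)

/-- The generators of the quadratic dual. -/
def dualGen : Module.Dual ℂ W →ₗ[ℂ] QuadraticDual R :=
  (dualMk R).toLinearMap ∘ₗ TensorAlgebra.ι ℂ

/-- The supercommutator of elements of degree `i` and `j`. -/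
def superBracket (i j : ℕ) : QuadraticDual R →ₗ[ℂ] QuadraticDual R →ₗ[ℂ] QuadraticDual R :=
  LinearMap.mul ℂ (QuadraticDual R) - (-1 : ℂ) ^ (i * j) • (LinearMap.mul ℂ (QuadraticDual R)).flip

theorem superBracket_apply (i j : ℕ) (x y : QuadraticDual R) :
    superBracket R i j x y = x * y - (-1 : ℂ) ^ (i * j) • (y * x) := rfl

/-- A family of subspaces that contains the generators in degree one and is closed under the
supercommutator. -/
structure IsLieFamily (S : ℕ → Submodule ℂ (QuadraticDual R)) : Prop where
  gen_mem : ∀ ξ, dualGen R ξ ∈ S 1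
  bracket_mem : ∀ i j x y, x ∈ S i → y ∈ S j → superBracket R i j x y ∈ S (i + j)

/-- The degree `k` component of the Lie sub-superalgebra of the quadratic dual generated by the
odd generators. -/
def liePart (k : ℕ) : Submodule ℂ (QuadraticDual R) :=
  ⨅ (S : ℕ → Submodule ℂ (QuadraticDual R)) (_ : IsLieFamily R S), S k

theorem mem_liePart {k : ℕ} {x : QuadraticDual R} :
    x ∈ liePart R k ↔ ∀ S, IsLieFamily R S → x ∈ S k := by
  simp [liePart]

theorem isLieFamily_liePart : IsLieFamily R (liePart R) where
  gen_mem ξ := (mem_liePart R).2 fun _ hS => hS.gen_mem ξ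
  bracket_mem i j x y hx hy := (mem_liePart R).2 fun S hS =>
    hS.bracket_mem i j x y ((mem_liePart R).1 hx S hS) ((mem_liePart R).1 hy S hS)

theorem liePart_le {S : ℕ → Submodule ℂ (QuadraticDual R)} (hS : IsLieFamily R S) (k : ℕ) :
    liePart R k ≤ S k := fun _ hx => (mem_liePart R).1 hx S hS

theorem liePart_zero : liePart R 0 = ⊥ := by
  have h : IsLieFamily R (fun k => if k = 0 then ⊥ else ⊤) :=
    { gen_mem := fun ξ => by simp
      bracket_mem := fun i j x y hx hy => by
        by_cases hi : i = 0
        · have : x = 0 := by simpa [hi] using hx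
          simp [this]
        · simp [hi] }
  simpa using liePart_le R h 0

instance [FiniteDimensional ℂ W] (k : ℕ) : FiniteDimensional ℂ (liePart R k) := by
  have h : IsLieFamily R (fun k => LinearMap.range (dualGen R) ^ k) :=
    { gen_mem := fun ξ => by simp
      bracket_mem := fun i j x y hx hy => by
        rw [superBracket_apply]
        refine Submodule.sub_mem _ ?_ (Submodule.smul_mem _ _ ?_)
        · rw [pow_add]; exact Submodule.mul_mem_mul hx hy
        · rw [add_comm, pow_add]; exact Submodule.mul_mem_mul hy hx }
  have hfg : (LinearMap.range (dualGen R) ^ k).FG :=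
    Submodule.FG.pow (Module.Finite.iff_fg.1 inferInstance) k
  have : FiniteDimensional ℂ ↥(LinearMap.range (dualGen R) ^ k) := Module.Finite.iff_fg.2 hfg
  exact Submodule.finiteDimensional_of_le (liePart_le R h k)

/-- The Lie superalgebra attached to a quadratic algebra with generators `W` and relations `R`:
the Lie sub-superalgebra of the quadratic dual generated by the dual space of `W`, which is placed
in degree one and hence odd. -/
def dualLie [FiniteDimensional ℂ W] : GradedLieSuperalgebra where
  comp k := liePart R k
  bracket {i j k} h := LinearMap.mk₂ ℂ
    (fun x y => ⟨superBracket R i j x y, h ▸ (isLieFamily_liePart R).bracket_mem i j x y x.2 y.2⟩)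
    (fun _ _ _ => by ext; simp) (fun _ _ _ => by ext; simp) (fun _ _ _ => by ext; simp)
    (fun _ _ _ => by ext; simp)
  skew {i j k} h h' x y := by
    ext
    simp only [LinearMap.mk₂_apply, Submodule.coe_neg, Submodule.coe_smul, superBracket_apply,
      mul_comm j i, smul_sub, smul_smul, neg_one_pow_mul_self, one_smul, neg_sub]
  jacobi {i j l ij jl il m} hij hjl hil h₁ h₂ h₃ x y z := by
    subst hij hjl hil
    ext
    have hs : ∀ a b c : ℕ, (-1 : ℂ) ^ (a * (b + c)) = (-1) ^ (a * b) * (-1) ^ (a * c) :=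
      fun a b c => by rw [mul_add, pow_add]
    have hs' : ∀ a b c : ℕ, (-1 : ℂ) ^ ((a + b) * c) = (-1) ^ (a * c) * (-1) ^ (b * c) :=
      fun a b c => by rw [add_mul, pow_add]
    have h1 := neg_one_pow_mul_self (i * j)
    simp only [LinearMap.mk₂_apply, Submodule.coe_add, Submodule.coe_smul, superBracket_apply,
      hs, hs', mul_comm j i, mul_sub, sub_mul, smul_sub, smul_mul_assoc, mul_smul_comm, smul_smul,
      mul_assoc, ← mul_assoc ((-1 : ℂ) ^ (i * j)) ((-1 : ℂ) ^ (i * j)), h1, one_mul]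
    module

/-- The inclusion of the Lie superalgebra in the quadratic dual. -/
def lieIncl [FiniteDimensional ℂ W] (k : ℕ) : (dualLie R).comp k →ₗ[ℂ] QuadraticDual R :=
  (liePart R k).subtype

theorem lieIncl_bracket [FiniteDimensional ℂ W] {i j k : ℕ} (h : i + j = k)
    (x : (dualLie R).comp i) (y : (dualLie R).comp j) :
    lieIncl R k ((dualLie R).bracket h x y) =
      lieIncl R i x * lieIncl R j y - (-1 : ℂ) ^ (i * j) • (lieIncl R j y * lieIncl R i x) := rfl

theorem lieIncl_injective [FiniteDimensional ℂ W] (k : ℕ) : Function.Injective (lieIncl R k) :=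
  Subtype.val_injective

/-- The generators as elements of degree one of the Lie superalgebra. -/
def lieGen [FiniteDimensional ℂ W] : Module.Dual ℂ W →ₗ[ℂ] (dualLie R).comp 1 :=
  (dualGen R).codRestrict (liePart R 1) (isLieFamily_liePart R).gen_mem

theorem lieIncl_lieGen [FiniteDimensional ℂ W] (ξ : Module.Dual ℂ W) :
    lieIncl R 1 (lieGen R ξ) = dualGen R ξ := rfl

variable {R} in
/-- The homomorphism with prescribed values on the generators of the quadratic dual. -/
def dualLift {B : Type} [Ring B] [Algebra ℂ B] (g : Module.Dual ℂ W →ₗ[ℂ] B)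
    (hg : ∀ η ∈ orthogonalRelations R,
      TensorProduct.lift ((LinearMap.mul ℂ B).compl₁₂ g g) η = 0) : QuadraticDual R →ₐ[ℂ] B :=
  RingQuot.liftAlgHom ℂ ⟨TensorAlgebra.lift ℂ g, by
    rintro _ _ ⟨η, hη⟩
    rw [map_zero, ← hg η hη]
    generalize η = η
    induction η using TensorProduct.induction_on with
    | zero => simp
    | tmul a b => simp [tensorSquare]
    | add a b ha hb => rw [map_add, map_add, map_add, ha, hb]⟩

theorem dualLift_gen {B : Type} [Ring B] [Algebra ℂ B] (g : Module.Dual ℂ W →ₗ[ℂ] B) (hg)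
    (ξ : Module.Dual ℂ W) : dualLift (R := R) g hg (dualGen R ξ) = g ξ := by
  refine (RingQuot.liftAlgHom_mkAlgHom_apply _ _ _ _).trans ?_
  simp

theorem dual_algHom_ext {B : Type} [Ring B] [Algebra ℂ B] {F G : QuadraticDual R →ₐ[ℂ] B}
    (h : ∀ ξ, F (dualGen R ξ) = G (dualGen R ξ)) : F = G := by
  refine RingQuot.ringQuot_ext' ℂ _ _ (TensorAlgebra.hom_ext ?_)
  ext ξ
  exact h ξ

theorem lift_dualGen {η : Module.Dual ℂ W ⊗[ℂ] Module.Dual ℂ W} (h : η ∈ orthogonalRelations R) :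
    TensorProduct.lift
      ((LinearMap.mul ℂ (QuadraticDual R)).compl₁₂ (dualGen R) (dualGen R)) η = 0 := by
  have e : dualMk R (tensorSquare (Module.Dual ℂ W) η) = 0 :=
    (RingQuot.mkAlgHom_rel ℂ (DualRel.of (R := R) η h)).trans (map_zero (dualMk R))
  refine Eq.trans ?_ e
  clear h e
  induction η using TensorProduct.induction_on with
  | zero => simp
  | tmul a b => simp [tensorSquare, dualGen]
  | add a b ha hb => rw [map_add, map_add, map_add, ha, hb]

/-- If the relations contain the commutators, the quadratic dual is the universal enveloping
algebra of `dualLie R`. -/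
theorem dualLie_universal [FiniteDimensional ℂ W]
    (hR : ∀ v w : W, v ⊗ₜ[ℂ] w - w ⊗ₜ[ℂ] v ∈ R) {B : Type} [Ring B] [Algebra ℂ B]
    (f : ∀ k, (dualLie R).comp k →ₗ[ℂ] B)
    (hf : ∀ {i j k : ℕ} (h : i + j = k) (x : (dualLie R).comp i) (y : (dualLie R).comp j),
      f k ((dualLie R).bracket h x y) = f i x * f j y - (-1 : ℂ) ^ (i * j) • (f j y * f i x)) :
    ∃! F : QuadraticDual R →ₐ[ℂ] B, ∀ k x, F (lieIncl R k x) = f k x := by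
  let g : Module.Dual ℂ W →ₗ[ℂ] B := f 1 ∘ₗ lieGen R
  let β : Module.Dual ℂ W ⊗[ℂ] Module.Dual ℂ W →ₗ[ℂ] (dualLie R).comp 2 :=
    TensorProduct.lift (((dualLie R).bracket (show 1 + 1 = 2 from rfl)).compl₁₂ (lieGen R) (lieGen R))
  have hcomm : ∀ η ∈ orthogonalRelations R, TensorProduct.comm ℂ _ _ η = η := by
    intro η hη
    have inj : Function.Injective (TensorProduct.dualDistrib ℂ W W) :=
      (TensorProduct.dualDistribEquiv ℂ W W).injective
    refine inj (TensorProduct.ext' fun v w => ?_)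
    have h1 := hη _ (hR v w)
    rw [map_sub, sub_eq_zero] at h1
    rw [h1, ← TensorProduct.dualDistrib_apply_comm]
    rfl
  have hβ : ∀ η, lieIncl R 2 (β η) = TensorProduct.lift
      ((LinearMap.mul ℂ (QuadraticDual R)).compl₁₂ (dualGen R) (dualGen R))
        (η + TensorProduct.comm ℂ _ _ η) := by
    intro η
    induction η using TensorProduct.induction_on with
    | zero => simp
    | tmul a b =>
      simp [β, lieIncl_bracket, lieIncl_lieGen]
    | add a b ha hb =>
      rw [map_add, map_add, ha, hb, ← map_add, map_add (TensorProduct.comm ℂ _ _)]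
      congr 1
      abel
  have hg2 : ∀ η, f 2 (β η) = TensorProduct.lift ((LinearMap.mul ℂ B).compl₁₂ g g)
        (η + TensorProduct.comm ℂ _ _ η) := by
    intro η
    induction η using TensorProduct.induction_on with
    | zero => simp
    | tmul a b => simp [β, g, hf]
    | add a b ha hb =>
      rw [map_add, map_add, ha, hb, ← map_add, map_add (TensorProduct.comm ℂ _ _)]
      congr 1
      abel
  have hg : ∀ η ∈ orthogonalRelations R,
      TensorProduct.lift ((LinearMap.mul ℂ B).compl₁₂ g g) η = 0 := by
    intro η hη
    have h0 : β η = 0 := by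
      apply lieIncl_injective R 2
      refine (hβ η).trans ?_
      rw [hcomm η hη, map_add, lift_dualGen R hη, add_zero, map_zero]
    have h1 := hg2 η
    rw [h0, map_zero, hcomm η hη, map_add, ← two_smul ℂ] at h1
    exact (smul_eq_zero.1 h1.symm).resolve_left two_ne_zero
  refine ⟨dualLift g hg, fun k x => ?_, fun G hG => dual_algHom_ext R fun ξ => ?_⟩
  · let S : ℕ → Submodule ℂ (QuadraticDual R) := fun k =>
      (LinearMap.ker ((dualLift g hg).toLinearMap ∘ₗ lieIncl R k - f k)).map (lieIncl R k)
    have mem : ∀ k y, y ∈ S k ↔ ∃ x, dualLift g hg (lieIncl R k x) = f k x ∧ lieIncl R k x = y := by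
      intro k y
      simp only [S, Submodule.mem_map, LinearMap.mem_ker, LinearMap.sub_apply, sub_eq_zero]
      rfl
    have hS : IsLieFamily R S :=
      { gen_mem := fun ξ => (mem 1 _).2
          ⟨lieGen R ξ, by rw [lieIncl_lieGen, dualLift_gen]; rfl, lieIncl_lieGen R ξ⟩
        bracket_mem := fun i j x y hx hy => by
          obtain ⟨x, ex, rfl⟩ := (mem i x).1 hx
          obtain ⟨y, ey, rfl⟩ := (mem j y).1 hy
          refine (mem _ _).2 ⟨(dualLie R).bracket rfl x y, ?_, lieIncl_bracket R rfl x y⟩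
          rw [hf, lieIncl_bracket, map_sub, map_smul, map_mul, map_mul, ex, ey] }
    obtain ⟨y, ey, h⟩ := (mem k _).1 (liePart_le R hS k (Subtype.prop x : _ ∈ liePart R k))
    rwa [lieIncl_injective R k h] at ey
  · rw [dualLift_gen, ← lieIncl_lieGen]
    exact hG 1 (lieGen R ξ)

/-- The projection of the quadratic dual to its degree one component, the dual space of `W`. -/
def degreeOne : QuadraticDual R →ₗ[ℂ] Module.Dual ℂ W :=
  TrivSqZeroExt.sndHom ℂ (Module.Dual ℂ W) ∘ₗ
    (dualLift (R := R) (TrivSqZeroExt.inrHom ℂ (Module.Dual ℂ W)) fun η hη => by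
      clear hη
      induction η using TensorProduct.induction_on with
      | zero => simp
      | tmul a b => simp
      | add a b ha hb => rw [map_add, ha, hb, add_zero]).toLinearMap

theorem degreeOne_gen (ξ : Module.Dual ℂ W) : degreeOne R (dualGen R ξ) = ξ := by
  simp [degreeOne, dualLift_gen]

/-- An element of `W` as a functional on the degree one component of the Lie superalgebra. -/
def evalOne [FiniteDimensional ℂ W] (w : W) : Module.Dual ℂ ((dualLie R).comp 1) :=
  Module.Dual.eval ℂ W w ∘ₗ degreeOne R ∘ₗ lieIncl R 1

theorem d_gen_evalOne [FiniteDimensional ℂ W] (w : W) :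
    d (dualLie R) (gen (dualLie R) 1 (evalOne R w)) = 0 := by
  have h0 : ∀ x : (dualLie R).comp 0, x = 0 := fun x =>
    Subtype.ext ((Submodule.mem_bot ℂ).1 (liePart_zero R ▸ x.2))
  rw [d_gen, dGen_apply]
  rw [Finset.sum_eq_zero, smul_zero]
  rintro ⟨⟨i, j⟩, hp⟩ -
  refine Finset.sum_eq_zero fun a _ => Finset.sum_eq_zero fun b _ => ?_
  have hij : i + j = 1 := Finset.HasAntidiagonal.mem_antidiagonal.1 hp
  have : i = 0 ∨ j = 0 := by omega
  rcases this with rfl | rfl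
  · dsimp only
    rw [h0 (Module.finBasis ℂ ((dualLie R).comp 0) a)]
    simp
  · dsimp only
    rw [h0 (Module.finBasis ℂ ((dualLie R).comp 0) b)]
    simp

/-- The cohomology class of an element of `W`, viewed as a linear function on the degree one
component of the Lie superalgebra. -/
def classOne [FiniteDimensional ℂ W] (w : W) : Cohomology (dualLie R) :=
  Ideal.Quotient.mk (coboundaries (dualLie R))
    ⟨gen (dualLie R) 1 (evalOne R w), d_gen_evalOne R w⟩

end QuadraticDual

section Koszul

variable {A : Type} [CommRing A] [Algebra ℂ A] (𝒜 : ℕ → Submodule ℂ A)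

/-- The quadratic relations between the elements of degree one. -/
def quadraticRelations : Submodule ℂ (𝒜 1 ⊗[ℂ] 𝒜 1) :=
  LinearMap.ker (TensorProduct.lift
    ((LinearMap.mul ℂ A).compl₁₂ (𝒜 1).subtype (𝒜 1).subtype))

/-- The subspaces `𝒜 k` make `A` a quadratic algebra: a graded algebra with scalars in degree zero,
finite-dimensional in degree one, generated by its elements of degree one, and with all relations
following from quadratic ones. -/
structure IsQuadratic : Prop where
  graded : Nonempty (GradedAlgebra 𝒜)
  nontrivial : Nontrivial A
  degree_zero : 𝒜 0 = 1
  finite : FiniteDimensional ℂ (𝒜 1)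
  generated : Algebra.adjoin ℂ (𝒜 1 : Set A) = ⊤
  relations : ∀ t : TensorAlgebra ℂ (𝒜 1), TensorAlgebra.lift ℂ (𝒜 1).subtype t = 0 →
    t ∈ TwoSidedIdeal.span (tensorSquare (𝒜 1) '' (quadraticRelations 𝒜 : Set (𝒜 1 ⊗[ℂ] 𝒜 1)))

/-- The Koszul dual Lie superalgebra of a commutative graded algebra. -/
abbrev koszulDual [FiniteDimensional ℂ (𝒜 1)] : GradedLieSuperalgebra :=
  dualLie (quadraticRelations 𝒜)

/-- A commutative graded algebra is Koszul if it is quadratic and the cohomology algebra of the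
Chevalley-Eilenberg complex of its Koszul dual Lie superalgebra is equal to it, compatibly with the
identification of the elements of degree one with linear functions on the degree one component of
the Lie superalgebra. -/
def IsKoszul : Prop :=
  IsQuadratic 𝒜 ∧ ∃ _ : FiniteDimensional ℂ (𝒜 1),
    ∃ e : A ≃ₐ[ℂ] Cohomology (koszulDual 𝒜),
      ∀ w : 𝒜 1, e (w : A) = classOne (quadraticRelations 𝒜) w

end Koszul

section Quasimaps

variable (n N₁ N₂ : ℕ)

/-- The variables `f i s` (left) and `g i s` (right), `i = 1, …, n`, `-N₁ ≤ s ≤ N₂`. -/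
abbrev Var : Type :=
  (Fin n × Set.Icc (-(N₁ : ℤ)) (N₂ : ℤ)) ⊕ (Fin n × Set.Icc (-(N₁ : ℤ)) (N₂ : ℤ))

/-- The relation `r l = ∑_{s + t = l} ∑_i f i s * g i t`. -/
def relation (l : ℤ) : MvPolynomial (Var n N₁ N₂) ℂ :=
  ∑ s : Set.Icc (-(N₁ : ℤ)) (N₂ : ℤ), ∑ t : Set.Icc (-(N₁ : ℤ)) (N₂ : ℤ),
    if (s : ℤ) + t = l then
      ∑ i : Fin n, MvPolynomial.X (Sum.inl (i, s)) * MvPolynomial.X (Sum.inr (i, t)) else 0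

/-- The ideal generated by the relations `r l`, `-2 N₁ ≤ l ≤ 2 N₂`. -/
def relationIdeal : Ideal (MvPolynomial (Var n N₁ N₂) ℂ) :=
  Ideal.span (relation n N₁ N₂ '' Set.Icc (-2 * (N₁ : ℤ)) (2 * (N₂ : ℤ)))

/-- The algebra of homogeneous functions on quasimaps to the quadric of dimension `2n - 2`. -/
abbrev QuasimapAlgebra : Type := MvPolynomial (Var n N₁ N₂) ℂ ⧸ relationIdeal n N₁ N₂

/-- The grading by the degree in the variables. -/
def quasimapGrading (k : ℕ) : Submodule ℂ (QuasimapAlgebra n N₁ N₂) :=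
  (MvPolynomial.homogeneousSubmodule (Var n N₁ N₂) ℂ k).map
    (Ideal.Quotient.mkₐ ℂ (relationIdeal n N₁ N₂)).toLinearMap

end Quasimaps

end QuasimapKoszul

end

noncomputable section

namespace QuasimapKoszul

/-! The relations `r[l]` form a regular sequence in any order, and the quotient of a polynomial ring
by a regular sequence of quadrics is Koszul.

Regularity comes from leading terms. Weights on the variables are chosen so that, with `i` counted
from `0`, the monomial `f^i[s] g_i[t]` has weight `-(s+t)² - (s-t+[i=1])² - [i>1]`. In `r[l]` the
sum `s+t = l` is fixed and `s-t` has the parity of `l`, so exactly one monomial is heaviest: `i =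
0`, `s = t = l/2` for even `l`, and `i = 1`, `s = t-1` for odd `l`. These leading monomials are
products of two variables, and no variable occurs in two of them, so they behave like independent
variables. Replacing each leading monomial by its relation is a linear bijection
(`bijective_of_hasLead`) that reduces regularity to the case of monomials
(`isRegularFamily_of_hasLead`).

Now let `A` be the quotient by a regular family of quadrics. Such a family has no syzygies with
coefficients of degree less than two (`IsRegularFamily.eq_zero_of_syzygy`). Absence of constant
syzygies makes `L₂` exactly dual to the span of the quadrics (`lieTwoPairing_surjective`). Absence
of linear syzygies gives `[L₁, L₂] = 0`: a functional applied to the Jacobi identity of three odd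
generators is such a syzygy (`superBracket_lieTwoBasis`). Hence `L = L₁ ⊕ L₂`, and `C(L)` is the
Koszul complex of the quadrics: polynomials in the coordinates on `L₁`, with exterior generators
whose differentials are the negatives of the quadrics. By regularity its cohomology is `A`
(`exists_polyHom_add_d`, `exists_cohomology_equiv`).

That `A` is quadratic is elementary: commutators are among the relations, so the tensor algebra
modulo its quadratic relations is a quotient of the polynomial ring in which the quadrics vanish
(`mem_span_quadraticRelations`). -/

/-- Each member of the family `r` is a nonzerodivisor modulo any finite set of other members. -/
def IsRegularFamily {σ ι : Type} (r : ι → MvPolynomial σ ℂ) : Prop :=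
  ∀ (J : Finset ι) (l : ι), l ∉ J → ∀ p, p * r l ∈ Ideal.span (r '' J) → p ∈ Ideal.span (r '' J)

/-! ### Leading terms and regular families -/

section LeadingTerms

open MvPolynomial

variable {σ : Type} (w : σ → ℕ)

/-- The polynomials whose monomials have weight less than `k`. -/
def weightLT (k : ℕ) : Submodule ℂ (MvPolynomial σ ℂ) :=
  restrictSupport ℂ {u | Finsupp.weight w u < k}

variable {w}

theorem mem_weightLT {k : ℕ} {p : MvPolynomial σ ℂ} :
    p ∈ weightLT w k ↔ ∀ u ∈ p.support, Finsupp.weight w u < k := Iff.rfl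

theorem weightLT_mono {j k : ℕ} (h : j ≤ k) : weightLT w j ≤ weightLT w k :=
  fun _ hp _ hu => lt_of_lt_of_le (hp hu) h

theorem weightLT_zero : weightLT w 0 = ⊥ := by
  refine eq_bot_iff.2 fun p hp => (Submodule.mem_bot ℂ).2 ?_
  rw [← MvPolynomial.support_eq_empty, Finset.eq_empty_iff_forall_notMem]
  exact fun u hu => absurd (mem_weightLT.1 hp u hu) (Nat.not_lt_zero _)

theorem exists_mem_weightLT (p : MvPolynomial σ ℂ) : ∃ k, p ∈ weightLT w k :=
  ⟨p.support.sup (Finsupp.weight w) + 1, mem_weightLT.2 fun _ hu =>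
    Nat.lt_succ_of_le (Finset.le_sup (f := Finsupp.weight w) hu)⟩

theorem monomial_mem_weightLT {k : ℕ} {u : σ →₀ ℕ} (h : Finsupp.weight w u < k) (c : ℂ) :
    monomial u c ∈ weightLT w k :=
  (monomial_mem_restrictSupport ℂ).2 (Or.inl h)

/-- Membership in `weightLT w (j + 1)` means weight at most `j`; a strict and a weak bound add up to
a strict one, which avoids subtraction in `ℕ`. -/
theorem mul_mem_weightLT {i j : ℕ} {p q : MvPolynomial σ ℂ} (hp : p ∈ weightLT w i)
    (hq : q ∈ weightLT w (j + 1)) : p * q ∈ weightLT w (i + j) := by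
  classical
  refine mem_weightLT.2 fun u hu => ?_
  obtain ⟨x, hx, y, hy, rfl⟩ := Finset.mem_add.1 (support_mul p q hu)
  have h1 := mem_weightLT.1 hp x hx
  have h2 := mem_weightLT.1 hq y hy
  rw [map_add]
  omega

variable (w) in
/-- The monomial `u` occurs in `p` with coefficient one, and the others have smaller weight. -/
def HasLead (p : MvPolynomial σ ℂ) (u : σ →₀ ℕ) : Prop :=
  p - monomial u 1 ∈ weightLT w (Finsupp.weight w u)

theorem hasLead_monomial (u : σ →₀ ℕ) : HasLead w (monomial u (1 : ℂ)) u := by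
  simp [HasLead]

theorem HasLead.mem {p : MvPolynomial σ ℂ} {u : σ →₀ ℕ} (h : HasLead w p u) :
    p ∈ weightLT w (Finsupp.weight w u + 1) := by
  rw [← sub_add_cancel p (monomial u 1)]
  exact Submodule.add_mem _ (weightLT_mono (Nat.le_succ _) h)
    (monomial_mem_weightLT (Nat.lt_succ_self _) 1)

theorem HasLead.mul {p q : MvPolynomial σ ℂ} {u v : σ →₀ ℕ} (hp : HasLead w p u)
    (hq : HasLead w q v) : HasLead w (p * q) (u + v) := by
  -- Each summand has one factor strictly below its leading weight.
  have e : p * q - monomial (u + v) 1 =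
      (p - monomial u 1) * q + (q - monomial v 1) * monomial u 1 := by
    rw [← one_mul (1 : ℂ), ← monomial_mul]
    simp only [one_mul]
    ring
  rw [HasLead, e, map_add]
  refine Submodule.add_mem _ (mul_mem_weightLT hp hq.mem) ?_
  rw [add_comm]
  exact mul_mem_weightLT hq (hasLead_monomial u).mem

theorem HasLead.pow {p : MvPolynomial σ ℂ} {u : σ →₀ ℕ} (hp : HasLead w p u) (k : ℕ) :
    HasLead w (p ^ k) (k • u) := by
  induction k with
  | zero => simpa using hasLead_monomial (w := w) (0 : σ →₀ ℕ)
  | succ k ih => rw [pow_succ, succ_nsmul]; exact ih.mul hp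

theorem HasLead.prod {ι : Type} (s : Finset ι) {p : ι → MvPolynomial σ ℂ} {u : ι → σ →₀ ℕ}
    (h : ∀ i, HasLead w (p i) (u i)) : HasLead w (∏ i ∈ s, p i) (∑ i ∈ s, u i) := by
  classical
  induction s using Finset.induction_on with
  | empty => simpa using hasLead_monomial (w := w) (0 : σ →₀ ℕ)
  | insert i s hi ih => rw [Finset.prod_insert hi, Finset.sum_insert hi]; exact (h i).mul ih

/-- A linear map that preserves leading monomials is bijective. -/
theorem bijective_of_hasLead (F : MvPolynomial σ ℂ →ₗ[ℂ] MvPolynomial σ ℂ)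
    (hF : ∀ u, HasLead w (F (monomial u 1)) u) : Function.Bijective F := by
  -- The difference `F - id` strictly lowers the exhaustive filtration by weight, which starts at
  -- zero; injectivity and surjectivity follow by induction along it.
  have low : ∀ k, ∀ p ∈ weightLT w (k + 1), F p - p ∈ weightLT w k := by
    intro k p hp
    have e : F p - p = ∑ u ∈ p.support, p.coeff u • (F (monomial u 1) - monomial u 1) := by
      simp only [smul_sub, Finset.sum_sub_distrib, ← map_smul, ← map_sum, smul_eq_mul, mul_one,
        support_sum_monomial_coeff]
    rw [e]
    exact Submodule.sum_mem _ fun u hu => Submodule.smul_mem _ _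
      (weightLT_mono (Nat.lt_succ_iff.1 (mem_weightLT.1 hp u hu)) (hF u))
  constructor
  · refine (injective_iff_map_eq_zero F).2 fun p hp => ?_
    have : ∀ k, p ∈ weightLT w k → p = 0 := by
      intro k
      induction k with
      | zero => intro h; simpa [weightLT_zero] using h
      | succ k ih =>
        intro h
        have := low k p h
        rw [hp, zero_sub, neg_mem_iff] at this
        exact ih this
    obtain ⟨k, hk⟩ := exists_mem_weightLT (w := w) p
    exact this k hk
  · have : ∀ k, weightLT w k ≤ LinearMap.range F := by
      intro k
      induction k with
      | zero => simp [weightLT_zero]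
      | succ k ih =>
        intro p hp
        have := (LinearMap.range F).sub_mem ⟨p, rfl⟩ (ih (low k p hp))
        simpa using this
    intro p
    obtain ⟨k, hk⟩ := exists_mem_weightLT (w := w) p
    exact this k hk

variable {ι : Type} (a b : ι → σ)

/-- The exponent of the product of the variables `a l` and `b l`. -/
def pairExp (l : ι) : σ →₀ ℕ := Finsupp.single (a l) 1 + Finsupp.single (b l) 1

/-- The exponent of the largest power of the monomial `pairExp a b l` that divides `u`. -/
def pairMult (u : σ →₀ ℕ) (l : ι) : ℕ := min (u (a l)) (u (b l))

/-- What remains of `u` after division by all monomials `pairExp a b l`. -/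
def pairRest [Fintype ι] (u : σ →₀ ℕ) : σ →₀ ℕ := u - ∑ l, pairMult a b u l • pairExp a b l

variable {a b}

theorem pairExp_left [DecidableEq ι] (ha : Function.Injective a) (hab : ∀ i j, a i ≠ b j) (k l : ι) :
    pairExp a b k (a l) = if l = k then 1 else 0 := by
  classical
  simp [pairExp, Finsupp.single_apply, ha.eq_iff, (hab l k).symm, eq_comm]

theorem pairExp_right [DecidableEq ι] (hb : Function.Injective b) (hab : ∀ i j, a i ≠ b j)
    (k l : ι) : pairExp a b k (b l) = if l = k then 1 else 0 := by
  classical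
  simp [pairExp, Finsupp.single_apply, hb.eq_iff, hab k l, eq_comm]

theorem pairExp_eq_zero {k : ι} {v : σ} (h1 : a k ≠ v) (h2 : b k ≠ v) : pairExp a b k v = 0 := by
  classical
  simp [pairExp, h1, h2]

theorem pairMult_add [DecidableEq ι] (ha : Function.Injective a) (hb : Function.Injective b)
    (hab : ∀ i j, a i ≠ b j) (u : σ →₀ ℕ) (k l : ι) :
    pairMult a b (u + pairExp a b k) l = pairMult a b u l + if l = k then 1 else 0 := by
  simp only [pairMult, Finsupp.add_apply, pairExp_left ha hab, pairExp_right hb hab,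
    min_add_add_right]

variable [Fintype ι]

/-- Each variable occurs in at most one pair, so the powers extracted for different pairs do not
compete. This makes the truncated subtraction in `pairRest` exact. -/
theorem sum_pairMult_le (ha : Function.Injective a) (hb : Function.Injective b)
    (hab : ∀ i j, a i ≠ b j) (u : σ →₀ ℕ) : ∑ l, pairMult a b u l • pairExp a b l ≤ u := by
  classical
  intro v
  rw [Finsupp.finsetSum_apply]
  simp only [Finsupp.smul_apply, smul_eq_mul]
  by_cases h1 : ∃ k, a k = v
  · obtain ⟨k, rfl⟩ := h1
    simp [pairExp_left ha hab, pairMult]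
  by_cases h2 : ∃ k, b k = v
  · obtain ⟨k, rfl⟩ := h2
    simp [pairExp_right hb hab, pairMult]
  push Not at h1 h2
  simp [pairExp_eq_zero (h1 _) (h2 _)]

theorem pairRest_add (ha : Function.Injective a) (hb : Function.Injective b)
    (hab : ∀ i j, a i ≠ b j) (u : σ →₀ ℕ) (k : ι) :
    pairRest a b (u + pairExp a b k) = pairRest a b u := by
  classical
  simp only [pairRest, pairMult_add ha hb hab, add_smul, Finset.sum_add_distrib, ite_smul, one_smul,
    zero_smul, Finset.sum_ite_eq', Finset.mem_univ, if_true]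
  exact add_tsub_add_eq_tsub_right _ _ _

theorem pairRest_add_sum (ha : Function.Injective a) (hb : Function.Injective b)
    (hab : ∀ i j, a i ≠ b j) (u : σ →₀ ℕ) :
    pairRest a b u + ∑ l, pairMult a b u l • pairExp a b l = u :=
  tsub_add_cancel_of_le (sum_pairMult_le ha hb hab u)

variable (a b) in
/-- The linear map that replaces each factor `pairExp a b l` of a monomial by `r l`. -/
def replacePairs (r : ι → MvPolynomial σ ℂ) : MvPolynomial σ ℂ →ₗ[ℂ] MvPolynomial σ ℂ :=
  (basisMonomials σ ℂ).constr ℂ fun u =>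
    monomial (pairRest a b u) 1 * ∏ l, r l ^ pairMult a b u l

theorem replacePairs_monomial (r : ι → MvPolynomial σ ℂ) (u : σ →₀ ℕ) :
    replacePairs a b r (monomial u 1) =
      monomial (pairRest a b u) 1 * ∏ l, r l ^ pairMult a b u l := by
  rw [← congrFun (coe_basisMonomials σ ℂ) u, replacePairs, Module.Basis.constr_basis]

/-- The map is not multiplicative, but multiplication by a pair monomial only raises one
multiplicity and leaves the rest of the exponent alone. This is enough to transport membership in
ideals generated by pair monomials. -/
theorem replacePairs_mul (ha : Function.Injective a) (hb : Function.Injective b)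
    (hab : ∀ i j, a i ≠ b j) (r : ι → MvPolynomial σ ℂ) (k : ι) (p : MvPolynomial σ ℂ) :
    replacePairs a b r (p * monomial (pairExp a b k) 1) = replacePairs a b r p * r k := by
  classical
  have : replacePairs a b r ∘ₗ LinearMap.mulRight ℂ (monomial (pairExp a b k) 1) =
      LinearMap.mulRight ℂ (r k) ∘ₗ replacePairs a b r := by
    refine (basisMonomials σ ℂ).ext fun u => ?_
    simp only [coe_basisMonomials, LinearMap.comp_apply, LinearMap.mulRight_apply, monomial_mul,
      mul_one, replacePairs_monomial, pairRest_add ha hb hab, pairMult_add ha hb hab, pow_add,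
      Finset.prod_mul_distrib, pow_ite, pow_one, pow_zero, Finset.prod_ite_eq', Finset.mem_univ,
      if_true, mul_assoc]
  exact LinearMap.congr_fun this p

/-- Polynomials whose leading monomials are products of two variables, with no variable used
twice, form a regular family. -/
theorem isRegularFamily_of_hasLead (ha : Function.Injective a) (hb : Function.Injective b)
    (hab : ∀ i j, a i ≠ b j) {r : ι → MvPolynomial σ ℂ}
    (hr : ∀ l, HasLead w (r l) (pairExp a b l)) : IsRegularFamily r := by
  classical
  have hbij : Function.Bijective (replacePairs a b r) := by
    refine bijective_of_hasLead (w := w) _ fun u => ?_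
    rw [replacePairs_monomial]
    have := (hasLead_monomial (w := w) (pairRest a b u)).mul
      (HasLead.prod Finset.univ fun l => (hr l).pow (pairMult a b u l))
    rwa [pairRest_add_sum ha hb hab] at this
  intro J l hl p hp
  obtain ⟨c, hc⟩ := (Submodule.mem_span_image_finset_iff_exists_fun _).1 hp
  obtain ⟨P, rfl⟩ := hbij.2 p
  choose C hC using fun i => hbij.2 (c i)
  -- The relation `p * r l ∈ span (r '' J)`, pulled back along the bijection, becomes one between
  -- pair monomials.
  have key : P * monomial (pairExp a b l) 1 = ∑ i : J, C i * monomial (pairExp a b (i : ι)) 1 := by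
    apply hbij.1
    simp only [map_sum, replacePairs_mul ha hb hab, hC]
    exact hc.symm
  have hP : P ∈ Ideal.span ((fun i => monomial (pairExp a b i) (1 : ℂ)) '' J) := by
    have himg : (fun i => monomial (pairExp a b i) (1 : ℂ)) '' J =
        (fun s => monomial s (1 : ℂ)) '' (pairExp a b '' J) := by
      rw [Set.image_image]
    have h1 : P * monomial (pairExp a b l) 1 ∈
        Ideal.span ((fun s => monomial s (1 : ℂ)) '' (pairExp a b '' J)) := by
      rw [key, ← himg]
      exact Ideal.sum_mem _ fun i _ => Ideal.mul_mem_left _ _ (Ideal.subset_span ⟨i, i.2, rfl⟩)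
    rw [himg, mem_ideal_span_monomial_image]
    intro u hu
    -- Some pair monomial with `k ∈ J` divides `u` times the pair monomial of `l`. As `k ≠ l`, the
    -- two pairs share no variable, so it already divides `u`.
    obtain ⟨_, ⟨k, hk, rfl⟩, hle⟩ := mem_ideal_span_monomial_image.1 h1 (u + pairExp a b l) (by
      rw [mem_support_iff, coeff_mul_monomial, mul_one]
      exact mem_support_iff.1 hu)
    refine ⟨_, ⟨k, hk, rfl⟩, fun v => ?_⟩
    have hkl : k ≠ l := fun h => hl (h ▸ hk)
    have h2 := hle v
    rw [Finsupp.add_apply] at h2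
    by_cases e1 : a k = v
    · subst e1
      simpa [pairExp_left ha hab, hkl] using h2
    by_cases e2 : b k = v
    · subst e2
      simpa [pairExp_right hb hab, hkl] using h2
    simp [pairExp_eq_zero e1 e2]
  obtain ⟨D, hD⟩ := (Submodule.mem_span_image_finset_iff_exists_fun _).1 hP
  rw [← hD, map_sum]
  refine Ideal.sum_mem _ fun i _ => ?_
  rw [smul_eq_mul, replacePairs_mul ha hb hab]
  exact Ideal.mul_mem_left _ _ (Ideal.subset_span ⟨i, i.2, rfl⟩)

end LeadingTerms

/-! ### Lie superalgebras in degrees one and two: the Koszul complex -/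

section TwoStep

variable (L : GradedLieSuperalgebra)

/-- Degree two is even in `L`, so its coordinates are odd in the complex; moving one past `z` costs
the parity sign of `z`. -/
theorem gen_two_mul (ψ : Module.Dual ℂ (L.comp 2)) (z : CEAlgebra L) :
    gen L 2 ψ * z = parity L z * gen L 2 ψ := by
  induction z using ce_induction with
  | algebraMap c => simp [Algebra.commutes]
  | gen k φ =>
    rw [gen_comm, parity_gen, smul_mul_assoc, show (2 + 1) * (k + 1) = 2 * (k + 1) + (k + 1) by ring,
      pow_add, pow_mul]
    simp
  | add a b ha hb => rw [mul_add, ha, hb, map_add, add_mul]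
  | mul a b ha hb => rw [← mul_assoc, ha, mul_assoc, hb, map_mul, mul_assoc]

/-- Coordinates on the odd part of `L` are even, so every sign they produce is an even power of
`-1`. -/
theorem gen_one_mem_center (φ : Module.Dual ℂ (L.comp 1)) :
    gen L 1 φ ∈ Subalgebra.center ℂ (CEAlgebra L) := by
  refine Subalgebra.mem_center_iff.2 fun z => ?_
  induction z using ce_induction with
  | algebraMap c => exact Algebra.commutes c _
  | gen k ψ => rw [gen_comm, mul_comm (k + 1), pow_mul]; simp
  | add a b ha hb => rw [mul_add, add_mul, ha, hb]
  | mul a b ha hb => rw [mul_assoc, hb, ← mul_assoc, ha, mul_assoc]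

/-- The contraction of functionals with an element of degree two. -/
def contractGen (y : L.comp 2) (k : ℕ) : Module.Dual ℂ (L.comp k) →ₗ[ℂ] ℂ :=
  -- `Pi.single` extends the element by zero to all degrees, so that one formula serves every `k`.
  Module.Dual.eval ℂ (L.comp k) (Pi.single (M := L.comp) 2 y k)

theorem contractGen_two (y : L.comp 2) (φ : Module.Dual ℂ (L.comp 2)) :
    contractGen L y 2 φ = φ y := by
  simp [contractGen]

theorem contractGen_of_ne (y : L.comp 2) {k : ℕ} (hk : k ≠ 2) (φ : Module.Dual ℂ (L.comp k)) :
    contractGen L y k φ = 0 := by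
  simp [contractGen, Pi.single_eq_of_ne hk]

/-- The homomorphism `x ↦ [[parity x, ∂ x], [0, x]]`, which encodes the contraction `∂` with an
element of degree two. -/
def contractHom (y : L.comp 2) : CEAlgebra L →ₐ[ℂ] Matrix (Fin 2) (Fin 2) (CEAlgebra L) :=
  ceLift (fun k =>
    { toFun := fun φ =>
        !![parity L (gen L k φ), algebraMap ℂ _ (contractGen L y k φ); 0, gen L k φ]
      map_add' := fun φ ψ => by ext a b; fin_cases a <;> fin_cases b <;> simp
      map_smul' := fun c φ => by
        ext a b; fin_cases a <;> fin_cases b <;> simp [Algebra.smul_def] }) fun i j φ ψ => by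
    simp only [LinearMap.coe_mk, AddHom.coe_mk, Matrix.mul_fin_two, mul_zero, zero_mul, add_zero,
      zero_add]
    have e : parity L (gen L i φ) * algebraMap ℂ _ (contractGen L y j ψ) +
          algebraMap ℂ _ (contractGen L y i φ) * gen L j ψ =
        (-1 : ℂ) ^ ((i + 1) * (j + 1)) •
          (parity L (gen L j ψ) * algebraMap ℂ _ (contractGen L y i φ) +
            algebraMap ℂ _ (contractGen L y j ψ) * gen L i φ) := by
      rw [parity_gen, parity_gen, ← Algebra.commutes, ← Algebra.commutes, ← Algebra.smul_def,
        ← Algebra.smul_def, ← Algebra.smul_def, ← Algebra.smul_def]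
      -- Contraction values vanish outside degree two, so each surviving term has a degree-two
      -- factor, and the commutation sign reduces to the parity of the other factor.
      have h (m : ℕ) : ((-1 : ℂ) ^ (m + 1)) * (-1) ^ (m + 1) = 1 := neg_one_pow_mul_self _
      by_cases hi : i = 2
      · subst hi
        have h3 : (-1 : ℂ) ^ ((2 + 1) * (j + 1)) = (-1) ^ (j + 1) := by
          rw [add_mul, pow_add, pow_mul]; simp
        rw [h3, smul_add, smul_comm ((-1 : ℂ) ^ (j + 1)), smul_smul ((-1 : ℂ) ^ (j + 1)), h,
          one_smul, add_comm]
        by_cases hj : j = 2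
        · subst hj; rw [smul_comm]
        · simp [contractGen_of_ne L y hj]
      · by_cases hj : j = 2
        · subst hj
          have h3 : (-1 : ℂ) ^ ((i + 1) * (2 + 1)) = (-1) ^ (i + 1) := by
            rw [mul_comm, add_mul, pow_add, pow_mul]; simp
          rw [h3, contractGen_of_ne L y hi, smul_comm]
          simp
        · simp [contractGen_of_ne L y hi, contractGen_of_ne L y hj]
    ext a b
    fin_cases a <;> fin_cases b
    · simpa using congrArg (parity L) (gen_comm L i j φ ψ)
    · simpa using e
    · simp
    · simpa using gen_comm L i j φ ψ

/-- The contraction with an element of degree two. -/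
def contract (y : L.comp 2) (z : CEAlgebra L) : CEAlgebra L := contractHom L y z 0 1

theorem contractHom_gen (y : L.comp 2) (k : ℕ) (φ : Module.Dual ℂ (L.comp k)) :
    contractHom L y (gen L k φ) =
      !![parity L (gen L k φ), algebraMap ℂ _ (contractGen L y k φ); 0, gen L k φ] :=
  ceLift_gen L _ _ k φ

theorem contractHom_apply (y : L.comp 2) (z : CEAlgebra L) :
    contractHom L y z = !![parity L z, contract L y z; 0, z] := by
  suffices h : contractHom L y z 0 0 = parity L z ∧ contractHom L y z 1 0 = 0 ∧
      contractHom L y z 1 1 = z by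
    ext a b
    fin_cases a <;> fin_cases b
    · simpa using h.1
    · simp [contract]
    · simpa using h.2.1
    · simpa using h.2.2
  induction z using ce_induction with
  | algebraMap r => simp [AlgHom.commutes, Matrix.algebraMap_matrix_apply]
  | gen k φ => simp [contractHom_gen]
  | add x y hx hy => simp [hx, hy]
  | mul x y hx hy => simp [Matrix.mul_apply, hx, hy]

theorem contract_gen (y : L.comp 2) (k : ℕ) (φ : Module.Dual ℂ (L.comp k)) :
    contract L y (gen L k φ) = algebraMap ℂ _ (contractGen L y k φ) := by
  simp [contract, contractHom_gen]

theorem contract_algebraMap (y : L.comp 2) (c : ℂ) : contract L y (algebraMap ℂ _ c) = 0 := by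
  simp [contract, AlgHom.commutes, Matrix.algebraMap_matrix_apply]

theorem contract_add (y : L.comp 2) (a b : CEAlgebra L) :
    contract L y (a + b) = contract L y a + contract L y b := by
  simp [contract]

theorem contract_mul (y : L.comp 2) (a b : CEAlgebra L) :
    contract L y (a * b) = contract L y a * b + parity L a * contract L y b := by
  have h : contractHom L y (a * b) 0 1 = (contractHom L y a * contractHom L y b) 0 1 := by
    rw [map_mul]
  rw [contractHom_apply, contractHom_apply, contractHom_apply] at h
  simpa [Matrix.mul_apply, add_comm] using h

theorem dGen_one (h0 : ∀ z : L.comp 0, z = 0) (φ : Module.Dual ℂ (L.comp 1)) :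
    dGen L 1 φ = 0 := by
  rw [dGen_apply, Finset.sum_eq_zero, smul_zero]
  rintro ⟨⟨i, j⟩, hp⟩ -
  refine Finset.sum_eq_zero fun a _ => Finset.sum_eq_zero fun b _ => ?_
  have hij : i + j = 1 := Finset.HasAntidiagonal.mem_antidiagonal.1 hp
  have : i = 0 ∨ j = 0 := by omega
  rcases this with rfl | rfl
  · dsimp only
    rw [h0 (Module.finBasis ℂ (L.comp 0) a)]
    simp
  · dsimp only
    rw [h0 (Module.finBasis ℂ (L.comp 0) b)]
    simp

/-- A sum over a basis and its dual basis does not depend on the basis. -/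
theorem sum_bilin_basis_change {V B α β : Type} [AddCommGroup V] [Module ℂ V] [Ring B] [Algebra ℂ B]
    [Fintype α] [Fintype β] [DecidableEq α] [DecidableEq β] (b : Module.Basis α ℂ V)
    (x : Module.Basis β ℂ V)
    (g : Module.Dual ℂ V →ₗ[ℂ] B) (Q : V →ₗ[ℂ] V →ₗ[ℂ] ℂ) :
    ∑ i, ∑ j, Q (b i) (b j) • (g (b.coord i) * g (b.coord j)) =
      ∑ v, ∑ w, Q (x v) (x w) • (g (x.coord v) * g (x.coord w)) := by
  have key {γ : Type} [Fintype γ] [DecidableEq γ] (c : Module.Basis γ ℂ V)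
      (f : Module.Dual ℂ V) : ∑ i, f (c i) • g (c.coord i) = g f := by
    conv_rhs => rw [← c.sum_dual_apply_smul_coord f, map_sum]
    simp
  calc _ = ∑ i, g (b.coord i) * g (Q (b i)) := by
        refine Finset.sum_congr rfl fun i _ => ?_
        rw [← key b (Q (b i)), Finset.mul_sum]
        simp
    _ = ∑ i, ∑ w, Q (b i) (x w) • (g (b.coord i) * g (x.coord w)) := by
        refine Finset.sum_congr rfl fun i _ => ?_
        rw [← key x (Q (b i)), Finset.mul_sum]
        simp
    _ = ∑ w, g (Q.flip (x w)) * g (x.coord w) := by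
        rw [Finset.sum_comm]
        refine Finset.sum_congr rfl fun w _ => ?_
        rw [← key b (Q.flip (x w)), Finset.sum_mul]
        simp
    _ = _ := by
        rw [Finset.sum_comm]
        refine Finset.sum_congr rfl fun w _ => ?_
        rw [← key x (Q.flip (x w)), Finset.sum_mul]
        simp

variable {σ ι : Type}
  (x : Module.Basis σ ℂ (L.comp 1)) (y : Module.Basis ι ℂ (L.comp 2))

/-- Since `L₀ = 0`, only the splitting `2 = 1 + 1` contributes, and the arbitrary basis in the
definition of the differential may be exchanged for `x`. -/
theorem dGen_two [Fintype σ] [DecidableEq σ] (h0 : ∀ z : L.comp 0, z = 0) (ψ : Module.Dual ℂ (L.comp 2)) :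
    dGen L 2 ψ = -(1 / 2 : ℂ) • ∑ v, ∑ w, ψ (L.bracket (show 1 + 1 = 2 from rfl) (x v) (x w)) •
      (gen L 1 (x.coord v) * gen L 1 (x.coord w)) := by
  rw [dGen_apply]
  congr 1
  rw [Finset.sum_eq_single ⟨(1, 1), by simp⟩]
  · refine Eq.trans ?_ (sum_bilin_basis_change (Module.finBasis ℂ (L.comp 1)) x (gen L 1)
      ((L.bracket (show 1 + 1 = 2 from rfl)).compr₂ ψ))
    simp
  · rintro ⟨⟨i, j⟩, hp⟩ - hne
    refine Finset.sum_eq_zero fun a _ => Finset.sum_eq_zero fun b _ => ?_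
    have hij : i + j = 2 := Finset.HasAntidiagonal.mem_antidiagonal.1 hp
    have : i = 0 ∨ j = 0 := by
      by_contra! h
      apply hne
      have h1 : i = 1 := by omega
      have h2 : j = 1 := by omega
      subst h1 h2
      rfl
    rcases this with rfl | rfl
    · dsimp only
      rw [h0 (Module.finBasis ℂ (L.comp 0) a)]
      simp
    · dsimp only
      rw [h0 (Module.finBasis ℂ (L.comp 0) b)]
      simp
  · simp

/-- Polynomials in the coordinates on the degree one component. -/
def polyHom : MvPolynomial σ ℂ →ₐ[ℂ] CEAlgebra L :=
  -- Evaluation of polynomials needs a commutative target, which the centre provides.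
  (Subalgebra.center ℂ (CEAlgebra L)).val.comp
    (MvPolynomial.aeval fun v => ⟨gen L 1 (x.coord v), gen_one_mem_center L _⟩)

theorem polyHom_X (v : σ) : polyHom L x (MvPolynomial.X v) = gen L 1 (x.coord v) := by
  simp [polyHom]

theorem mul_polyHom (p : MvPolynomial σ ℂ) (z : CEAlgebra L) :
    z * polyHom L x p = polyHom L x p * z :=
  Subalgebra.mem_center_iff.1 (Subtype.prop (MvPolynomial.aeval
    (fun v => (⟨gen L 1 (x.coord v), gen_one_mem_center L _⟩ :
      Subalgebra.center ℂ (CEAlgebra L))) p)) z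

theorem parity_polyHom (p : MvPolynomial σ ℂ) : parity L (polyHom L x p) = polyHom L x p := by
  have : (parity L).comp (polyHom L x) = polyHom L x := by
    refine MvPolynomial.algHom_ext fun v => ?_
    rw [AlgHom.comp_apply, polyHom_X, parity_gen]
    simp
  exact DFunLike.congr_fun this p

theorem d_polyHom (h0 : ∀ z : L.comp 0, z = 0) (p : MvPolynomial σ ℂ) :
    d L (polyHom L x p) = 0 := by
  induction p using MvPolynomial.induction_on with
  | C c =>
    rw [← MvPolynomial.algebraMap_eq, AlgHom.commutes, d_algebraMap]
  | add p q hp hq => rw [map_add, map_add, hp, hq, add_zero]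
  | mul_X p v hp => rw [map_mul, d_mul, hp, polyHom_X, d_gen, dGen_one L h0]; simp

theorem contract_polyHom (z : L.comp 2) (p : MvPolynomial σ ℂ) :
    contract L z (polyHom L x p) = 0 := by
  induction p using MvPolynomial.induction_on with
  | C c =>
    rw [← MvPolynomial.algebraMap_eq, AlgHom.commutes, contract_algebraMap]
  | add p q hp hq => rw [map_add, contract_add, hp, hq, add_zero]
  | mul_X p v hp =>
    rw [map_mul, contract_mul, hp, polyHom_X, contract_gen, contractGen_of_ne L z (by norm_num)]
    simp

/-- The projection of the Chevalley-Eilenberg algebra to the polynomials in the coordinates on the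
degree one component. -/
def polyProj [Fintype σ] : CEAlgebra L →ₐ[ℂ] MvPolynomial σ ℂ :=
  ceLift (fun k => ∑ v, (Module.Dual.eval ℂ (L.comp k)
      (Pi.single (M := L.comp) 1 (x v) k)).smulRight (MvPolynomial.X v)) fun i j φ ψ => by
    by_cases hi : i = 1
    · subst hi
      rw [mul_comm (1 + 1), pow_mul, mul_comm]
      by_cases hj : j = 1
      · subst hj; simp
      · simp [Pi.single_eq_of_ne hj]
    · simp [Pi.single_eq_of_ne hi]

/-- The polynomials are a retract of the complex; identities between them can therefore be tested
after projection. -/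
theorem polyProj_polyHom [Fintype σ] (p : MvPolynomial σ ℂ) : polyProj L x (polyHom L x p) = p := by
  classical
  have : (polyProj L x).comp (polyHom L x) = AlgHom.id ℂ _ := by
    refine MvPolynomial.algHom_ext fun v => ?_
    rw [AlgHom.comp_apply, polyHom_X, polyProj, ceLift_gen]
    simp [Finsupp.single_apply]
  exact DFunLike.congr_fun this p

/-- The subalgebra generated by the coordinates on the degree one component and the coordinates in
`J` on the degree two component. -/
def partialCE (J : Finset ι) : Subalgebra ℂ (CEAlgebra L) :=
  Algebra.adjoin ℂ (Set.range (polyHom L x) ∪ (fun l => gen L 2 (y.coord l)) '' J)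

variable {L x y}

theorem polyHom_mem (J : Finset ι) (p : MvPolynomial σ ℂ) : polyHom L x p ∈ partialCE L x y J :=
  Algebra.subset_adjoin (Or.inl ⟨p, rfl⟩)

theorem gen_two_mem {J : Finset ι} {l : ι} (h : l ∈ J) :
    gen L 2 (y.coord l) ∈ partialCE L x y J :=
  Algebra.subset_adjoin (Or.inr ⟨l, h, rfl⟩)

theorem partialCE_mono {J K : Finset ι} (h : J ⊆ K) : partialCE L x y J ≤ partialCE L x y K :=
  Algebra.adjoin_mono (Set.union_subset_union_right _ (Set.image_mono (by simpa using h)))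

theorem partialCE_induction {J : Finset ι} {P : CEAlgebra L → Prop}
    (poly : ∀ p, P (polyHom L x p)) (gen : ∀ l ∈ J, P (gen L 2 (y.coord l)))
    (add : ∀ a b, a ∈ partialCE L x y J → b ∈ partialCE L x y J → P a → P b → P (a + b))
    (mul : ∀ a b, a ∈ partialCE L x y J → b ∈ partialCE L x y J → P a → P b → P (a * b))
    {z : CEAlgebra L} (hz : z ∈ partialCE L x y J) : P z := by
  refine Algebra.adjoin_induction (p := fun z _ => P z) ?_ ?_ (fun a b ha hb => add a b ha hb)
    (fun a b ha hb => mul a b ha hb) hz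
  · rintro _ (⟨p, rfl⟩ | ⟨l, hl, rfl⟩)
    · exact poly p
    · exact gen l hl
  · intro c
    rw [← (polyHom L x).commutes c]
    exact poly _

theorem partialCE_empty {z : CEAlgebra L} (hz : z ∈ partialCE L x y ∅) : ∃ p, z = polyHom L x p := by
  refine partialCE_induction (P := fun z => ∃ p, z = polyHom L x p) (fun p => ⟨p, rfl⟩) (fun l hl => absurd hl (Finset.notMem_empty l))
    ?_ ?_ hz
  · rintro a b - - ⟨p, rfl⟩ ⟨q, rfl⟩
    exact ⟨p + q, (map_add _ _ _).symm⟩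
  · rintro a b - - ⟨p, rfl⟩ ⟨q, rfl⟩
    exact ⟨p * q, (map_mul _ _ _).symm⟩

theorem partialCE_univ [Fintype σ] [Fintype ι] (h : ∀ k, k ≠ 1 → k ≠ 2 → ∀ z : L.comp k, z = 0) (z : CEAlgebra L) :
    z ∈ partialCE L x y Finset.univ := by
  classical
  induction z using ce_induction with
  | algebraMap c => exact Subalgebra.algebraMap_mem _ c
  | gen k φ =>
    by_cases h1 : k = 1
    · subst h1
      rw [← x.sum_dual_apply_smul_coord φ, map_sum]
      refine Subalgebra.sum_mem _ fun v _ => ?_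
      rw [map_smul, ← polyHom_X]
      exact Subalgebra.smul_mem _ (polyHom_mem _ _) _
    by_cases h2 : k = 2
    · subst h2
      rw [← y.sum_dual_apply_smul_coord φ, map_sum]
      refine Subalgebra.sum_mem _ fun l _ => ?_
      rw [map_smul]
      exact Subalgebra.smul_mem _ (gen_two_mem (Finset.mem_univ l)) _
    have : φ = 0 := LinearMap.ext fun z => by rw [h k h1 h2 z, map_zero, map_zero]
    rw [this, map_zero]
    exact Subalgebra.zero_mem _
  | add a b ha hb => exact Subalgebra.add_mem _ ha hb
  | mul a b ha hb => exact Subalgebra.mul_mem _ ha hb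

theorem parity_mem_partialCE {J : Finset ι} {z : CEAlgebra L} (hz : z ∈ partialCE L x y J) :
    parity L z ∈ partialCE L x y J := by
  refine partialCE_induction (P := fun z => parity L z ∈ partialCE L x y J) (fun p => ?_) (fun l hl => ?_) ?_ ?_ hz
  · rw [parity_polyHom]; exact polyHom_mem J p
  · rw [parity_gen]; exact Subalgebra.smul_mem _ (gen_two_mem hl) _
  · intro a b _ _ ha hb
    rw [map_add]; exact Subalgebra.add_mem _ ha hb
  · intro a b _ _ ha hb
    rw [map_mul]; exact Subalgebra.mul_mem _ ha hb

theorem gen_two_mul_self (ψ : Module.Dual ℂ (L.comp 2)) : gen L 2 ψ * gen L 2 ψ = 0 := by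
  have h := gen_comm L 2 2 ψ ψ
  norm_num at h
  have h2 : (2 : ℂ) • (gen L 2 ψ * gen L 2 ψ) = 0 := by
    rw [two_smul]
    nth_rewrite 1 [h]
    exact neg_add_cancel _
  exact (smul_eq_zero.1 h2).resolve_left two_ne_zero

/-- The new coordinate squares to zero and passes every element up to parity, so `1` and this
coordinate generate the larger algebra as a module over the smaller one. -/
theorem exists_of_mem_insert [DecidableEq ι] {J : Finset ι} {j : ι} {z : CEAlgebra L}
    (hz : z ∈ partialCE L x y (insert j J)) : ∃ a ∈ partialCE L x y J, ∃ b ∈ partialCE L x y J,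
      z = a + b * gen L 2 (y.coord j) := by
  refine partialCE_induction (P := fun z => ∃ a ∈ partialCE L x y J, ∃ b ∈ partialCE L x y J,
      z = a + b * gen L 2 (y.coord j)) (fun p => ?_) (fun l hl => ?_) ?_ ?_ hz
  · exact ⟨_, polyHom_mem J p, 0, Subalgebra.zero_mem _, by simp⟩
  · rcases Finset.mem_insert.1 hl with rfl | hl
    · exact ⟨0, Subalgebra.zero_mem _, 1, Subalgebra.one_mem _, by simp⟩
    · exact ⟨_, gen_two_mem hl, 0, Subalgebra.zero_mem _, by simp⟩
  · rintro _ _ - - ⟨a, ha, b, hb, rfl⟩ ⟨a', ha', b', hb', rfl⟩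
    exact ⟨_, Subalgebra.add_mem _ ha ha', _, Subalgebra.add_mem _ hb hb', by
      rw [add_mul]; abel⟩
  · rintro _ _ - - ⟨a, ha, b, hb, rfl⟩ ⟨a', ha', b', hb', rfl⟩
    refine ⟨_, Subalgebra.mul_mem _ ha ha', a * b' + b * parity L a', Subalgebra.add_mem _
      (Subalgebra.mul_mem _ ha hb') (Subalgebra.mul_mem _ hb (parity_mem_partialCE ha')), ?_⟩
    have h1 := gen_two_mul L (y.coord j) a'
    have h2 := gen_two_mul L (y.coord j) b'
    have h3 := gen_two_mul_self (L := L) (y.coord j)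
    set e := gen L 2 (y.coord j)
    have h4 : b * e * (b' * e) = 0 := by
      rw [mul_assoc, ← mul_assoc e, h2, mul_assoc (parity L b'), h3, mul_zero, mul_zero]
    rw [add_mul, mul_add, mul_add, h4, mul_assoc b e a', h1, add_mul, mul_assoc, mul_assoc]
    abel

theorem contract_eq_zero {J : Finset ι} {j : ι} (hj : j ∉ J) {z : CEAlgebra L}
    (hz : z ∈ partialCE L x y J) : contract L (y j) z = 0 := by
  refine partialCE_induction (P := fun z => contract L (y j) z = 0) (fun p => ?_) (fun l hl => ?_) ?_ ?_ hz
  · exact contract_polyHom L x _ p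
  · have : j ≠ l := fun h => hj (h ▸ hl)
    rw [contract_gen, contractGen_two]
    simp [this]
  · intro a b _ _ ha hb
    rw [contract_add, ha, hb, add_zero]
  · intro a b _ _ ha hb
    rw [contract_mul, ha, hb, zero_mul, mul_zero, add_zero]

/-- Freeness of that module: contraction with `y j` kills the smaller algebra and recovers `b` up to
parity. -/
theorem eq_zero_of_add_mul {J : Finset ι} {j : ι} (hj : j ∉ J) {a b : CEAlgebra L}
    (ha : a ∈ partialCE L x y J) (hb : b ∈ partialCE L x y J)
    (h : a + b * gen L 2 (y.coord j) = 0) : a = 0 ∧ b = 0 := by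
  have hb0 : b = 0 := by
    have h1 := congrArg (contract L (y j)) h
    have hz : contract L (y j) 0 = 0 := by
      simpa using contract_algebraMap L (y j) 0
    rw [contract_add, contract_eq_zero hj ha, contract_mul, contract_eq_zero hj hb, contract_gen,
      contractGen_two, hz] at h1
    have h2 : parity L b = 0 := by simpa using h1
    rw [← parity_parity L b, h2, map_zero]
  exact ⟨by simpa [hb0] using h, hb0⟩

variable {r : ι → MvPolynomial σ ℂ} (h0 : ∀ z : L.comp 0, z = 0)
  (hr : ∀ l, d L (gen L 2 (y.coord l)) = -polyHom L x (r l))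

include h0 hr

theorem d_mem_partialCE {J : Finset ι} {z : CEAlgebra L} (hz : z ∈ partialCE L x y J) :
    d L z ∈ partialCE L x y J := by
  refine partialCE_induction (P := fun z => d L z ∈ partialCE L x y J)
    (fun p => ?_) (fun l hl => ?_) ?_ ?_ hz
  · rw [d_polyHom L x h0]; exact Subalgebra.zero_mem _
  · rw [hr]; exact Subalgebra.neg_mem _ (polyHom_mem J _)
  · intro a b _ _ ha hb
    rw [map_add]; exact Subalgebra.add_mem _ ha hb
  · intro a b ha' hb' ha hb
    rw [d_mul]
    exact Subalgebra.add_mem _ (Subalgebra.mul_mem _ ha hb')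
      (Subalgebra.mul_mem _ (parity_mem_partialCE ha') hb)

/-- Differentials of generators project into the ideal, and the Leibniz rule preserves this. It
shows that a polynomial coboundary lies in the ideal of the quadrics. -/
theorem polyProj_d_mem [Fintype σ] {J : Finset ι} {z : CEAlgebra L} (hz : z ∈ partialCE L x y J) :
    polyProj L x (d L z) ∈ Ideal.span (r '' J) := by
  refine partialCE_induction (P := fun z => polyProj L x (d L z) ∈ Ideal.span (r '' J))
    (fun p => ?_) (fun l hl => ?_) ?_ ?_ hz
  · rw [d_polyHom L x h0, map_zero]; exact Ideal.zero_mem _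
  · rw [hr, map_neg, polyProj_polyHom]
    exact (Ideal.neg_mem_iff _).2 (Ideal.subset_span ⟨l, hl, rfl⟩)
  · intro a b _ _ ha hb
    rw [map_add, map_add]; exact Ideal.add_mem _ ha hb
  · intro a b _ _ ha hb
    rw [d_mul, map_add, map_mul, map_mul]
    exact Ideal.add_mem _ (Ideal.mul_mem_right _ _ ha) (Ideal.mul_mem_left _ _ hb)

/-- Each `r l` is the differential of minus a coordinate, and polynomials are closed. -/
theorem exists_primitive {J : Finset ι} {p : MvPolynomial σ ℂ} (hp : p ∈ Ideal.span (r '' J)) :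
    ∃ t ∈ partialCE L x y J, polyHom L x p = d L t := by
  obtain ⟨c, rfl⟩ := (Submodule.mem_span_image_finset_iff_exists_fun' _).1 hp
  refine ⟨-∑ i ∈ J, polyHom L x (c i) * gen L 2 (y.coord i), Subalgebra.neg_mem _
    (Subalgebra.sum_mem _ fun i hi => Subalgebra.mul_mem _ (polyHom_mem J _) (gen_two_mem hi)), ?_⟩
  rw [map_neg, map_sum, map_sum, ← Finset.sum_neg_distrib]
  refine Finset.sum_congr rfl fun i _ => ?_
  rw [d_mul, d_polyHom L x h0, hr, parity_polyHom, smul_eq_mul, map_mul]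
  simp

/-- Every cocycle is cohomologous to a polynomial in the coordinates of degree one. -/
theorem exists_polyHom_add_d [Fintype σ] (hreg : IsRegularFamily r) (J : Finset ι) :
    ∀ z ∈ partialCE L x y J, d L z = 0 →
      ∃ p, ∃ w ∈ partialCE L x y J, z = polyHom L x p + d L w := by
  classical
  induction J using Finset.induction_on with
  | empty =>
    intro z hz _
    obtain ⟨p, rfl⟩ := partialCE_empty hz
    exact ⟨p, 0, Subalgebra.zero_mem _, by simp⟩
  | insert j J hj ih =>
    intro z hz hdz
    obtain ⟨a, ha, b, hb, rfl⟩ := exists_of_mem_insert hz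
    set e := gen L 2 (y.coord j)
    set s := polyHom L x (r j)
    have hsm : s ∈ partialCE L x y J := polyHom_mem J _
    have hds : d L s = 0 := d_polyHom L x h0 _
    -- The differential of `a + b * e`, sorted by powers of `e`; by freeness both parts vanish, so
    -- `b` is closed and `d a = parity b * s`.
    have h1 : (d L a - parity L b * s) + d L b * e = 0 := by
      rw [← hdz, map_add, d_mul, hr]
      simp only [mul_neg]
      abel
    obtain ⟨h2, h3⟩ := eq_zero_of_add_mul hj (Subalgebra.sub_mem _ (d_mem_partialCE h0 hr ha)
      (Subalgebra.mul_mem _ (parity_mem_partialCE hb) hsm)) (d_mem_partialCE h0 hr hb) h1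
    obtain ⟨p, b', hb', rfl⟩ := ih b hb h3
    -- With `b = p + d b'`, the equation for `d a` makes `p * r j` a coboundary not involving `e`;
    -- regularity then puts `p` in the ideal of the earlier quadrics.
    have h4 : polyHom L x (p * r j) = d L (a + parity L b' * s) := by
      rw [map_add, sub_eq_zero.1 h2, d_mul, hds, map_add, parity_polyHom, d_parity, map_mul]
      simp only [mul_zero, add_zero, add_mul, neg_mul]
      abel
    have h5 : p ∈ Ideal.span (r '' J) := by
      refine hreg J j hj p ?_
      rw [← polyProj_polyHom L x (p * r j), h4]
      exact polyProj_d_mem h0 hr (Subalgebra.add_mem _ ha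
        (Subalgebra.mul_mem _ (parity_mem_partialCE hb') hsm))
    obtain ⟨t, ht, h6⟩ := exists_primitive h0 hr h5
    have htb := Subalgebra.add_mem _ ht hb'
    rw [h6, ← map_add] at hdz ⊢
    set c := t + b'
    -- Now `b = d c` is exact. Subtracting the coboundary `d (c * e)` removes `e` from the cocycle,
    -- and induction applies to what is left.
    have h7 : a + d L c * e = (a + parity L c * s) + d L (c * e) := by
      rw [d_mul, hr]
      simp only [mul_neg]
      abel
    rw [h7] at hdz ⊢
    rw [map_add _ (a + parity L c * s), d_d, add_zero] at hdz
    obtain ⟨q, w, hw, h8⟩ := ih _ (Subalgebra.add_mem _ ha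
      (Subalgebra.mul_mem _ (parity_mem_partialCE htb) hsm)) hdz
    refine ⟨q, w + c * e, Subalgebra.add_mem _ (partialCE_mono (Finset.subset_insert j J) hw)
      (Subalgebra.mul_mem _ (partialCE_mono (Finset.subset_insert j J) htb)
        (gen_two_mem (Finset.mem_insert_self j J))), ?_⟩
    rw [h8, map_add, add_assoc]

/-- The cohomology of a Lie superalgebra concentrated in degrees one and two whose bracket is dual
to a regular family of quadrics is the quotient of the polynomial ring by the quadrics. -/
theorem exists_cohomology_equiv [Fintype σ] [Fintype ι] (hreg : IsRegularFamily r)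
    (h : ∀ k, k ≠ 1 → k ≠ 2 → ∀ z : L.comp k, z = 0) {I : Ideal (MvPolynomial σ ℂ)}
    (hI : I = Ideal.span (Set.range r)) :
    ∃ e : (MvPolynomial σ ℂ ⧸ I) ≃ₐ[ℂ] Cohomology L, ∀ p,
      e (Ideal.Quotient.mk I p) =
        Ideal.Quotient.mk (coboundaries L) ⟨polyHom L x p, d_polyHom L x h0 p⟩ := by
  have hspan : I = Ideal.span (r '' (Finset.univ : Finset ι)) := by
    rw [hI, Finset.coe_univ, Set.image_univ]
  let F : MvPolynomial σ ℂ →ₐ[ℂ] Cohomology L := (Ideal.Quotient.mkₐ ℂ (coboundaries L)).comp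
    ((polyHom L x).codRestrict (cocycles L) (d_polyHom L x h0))
  have hF : ∀ p, F p =
      Ideal.Quotient.mk (coboundaries L) ⟨polyHom L x p, d_polyHom L x h0 p⟩ := fun p => rfl
  have hker : ∀ p, F p = 0 ↔ p ∈ I := by
    intro p
    rw [hF, Ideal.Quotient.eq_zero_iff_mem, hspan]
    constructor
    · rintro ⟨w, hw⟩
      rw [← polyProj_polyHom L x p]
      have := polyProj_d_mem h0 hr (partialCE_univ (x := x) (y := y) h w)
      rwa [hw] at this
    · intro hp
      obtain ⟨t, -, ht⟩ := exists_primitive h0 hr hp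
      exact ⟨t, ht.symm⟩
  refine ⟨AlgEquiv.ofBijective (Ideal.Quotient.liftₐ I F fun p hp => (hker p).2 hp) ⟨?_, ?_⟩,
    fun p => rfl⟩
  · refine (injective_iff_map_eq_zero _).2 fun q hq => ?_
    obtain ⟨p, rfl⟩ := Ideal.Quotient.mk_surjective q
    exact Ideal.Quotient.eq_zero_iff_mem.2 ((hker p).1 hq)
  · intro c
    obtain ⟨⟨z, hz⟩, rfl⟩ := Ideal.Quotient.mk_surjective c
    obtain ⟨p, w, -, hpw⟩ := exists_polyHom_add_d h0 hr hreg Finset.univ z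
      (partialCE_univ h z) hz
    refine ⟨Ideal.Quotient.mk I p, (Ideal.Quotient.eq.2 ?_ : F p = _)⟩
    refine ⟨-w, ?_⟩
    simp only [hpw, map_neg]
    change _ = polyHom L x p - (polyHom L x p + d L w)
    abel

end TwoStep

/-! ### Syzygies of quadrics -/

section Quadrics

open MvPolynomial

variable {σ : Type}

theorem homogeneousComponent_mul_of_isHomogeneous {q : MvPolynomial σ ℂ} {m : ℕ}
    (hq : q.IsHomogeneous m) (c : MvPolynomial σ ℂ) (k : ℕ) :
    homogeneousComponent (k + m) (c * q) = homogeneousComponent k c * q := by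
  have hi (i : ℕ) : homogeneousComponent (k + m) (homogeneousComponent i c * q) =
      if i = k then homogeneousComponent i c * q else 0 := by
    rw [homogeneousComponent_of_mem ((homogeneousComponent_isHomogeneous i c).mul hq)]
    simp [eq_comm]
  conv_lhs => rw [← sum_homogeneousComponent c, Finset.sum_mul, map_sum]
  simp only [hi, Finset.sum_ite_eq', Finset.mem_range]
  split_ifs with h
  · rfl
  · rw [homogeneousComponent_eq_zero _ _ (by omega), zero_mul]

theorem homogeneousComponent_mul_eq_zero {q : MvPolynomial σ ℂ} {m : ℕ}
    (hq : q.IsHomogeneous m) (c : MvPolynomial σ ℂ) {n : ℕ} (hn : n < m) :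
    homogeneousComponent n (c * q) = 0 := by
  have hi (i : ℕ) : homogeneousComponent n (homogeneousComponent i c * q) = 0 := by
    rw [homogeneousComponent_of_mem ((homogeneousComponent_isHomogeneous i c).mul hq), if_neg]
    omega
  conv_lhs => rw [← sum_homogeneousComponent c, Finset.sum_mul, map_sum]
  simp only [hi, Finset.sum_const_zero]

theorem homogeneousComponent_eq_zero_of_mem_span {s : Set (MvPolynomial σ ℂ)} {m : ℕ}
    (hs : ∀ q ∈ s, q.IsHomogeneous m) {p : MvPolynomial σ ℂ} (hp : p ∈ Ideal.span s) {n : ℕ}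
    (hn : n < m) : homogeneousComponent n p = 0 := by
  obtain ⟨k, f, g, rfl⟩ := Submodule.mem_span_set'.1 hp
  rw [map_sum]
  exact Finset.sum_eq_zero fun i _ => homogeneousComponent_mul_eq_zero (hs _ (g i).2) _ hn

theorem homogeneousComponent_mem_span {s : Set (MvPolynomial σ ℂ)} {m : ℕ}
    (hs : ∀ q ∈ s, q.IsHomogeneous m) {p : MvPolynomial σ ℂ} (hp : p ∈ Ideal.span s) :
    homogeneousComponent m p ∈ Submodule.span ℂ s := by
  obtain ⟨k, f, g, rfl⟩ := Submodule.mem_span_set'.1 hp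
  rw [map_sum]
  refine Submodule.sum_mem _ fun i _ => ?_
  have := homogeneousComponent_mul_of_isHomogeneous (hs _ (g i).2) (f i) 0
  rw [zero_add, homogeneousComponent_zero, ← smul_eq_C_mul] at this
  rw [smul_eq_mul, this]
  exact Submodule.smul_mem _ _ (Submodule.subset_span (g i).2)

/-- A regular family of quadrics has no syzygies of degree less than two. -/
theorem IsRegularFamily.eq_zero_of_syzygy {ι : Type} [Fintype ι] {r : ι → MvPolynomial σ ℂ}
    (hreg : IsRegularFamily r) (hr : ∀ l, (r l).IsHomogeneous 2) {n : ℕ} (hn : n < 2)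
    {c : ι → MvPolynomial σ ℂ} (hc : ∀ l, (c l).IsHomogeneous n) (h : ∑ l, c l * r l = 0) (l : ι) :
    c l = 0 := by
  classical
  -- The syzygy puts `c l * r l` in the ideal of the other quadrics; regularity cancels `r l`. That
  -- ideal has no nonzero component in degree less than two.
  have h1 : c l ∈ Ideal.span (r '' (Finset.univ.erase l : Finset ι)) := by
    refine hreg _ l (Finset.notMem_erase l _) _ ?_
    rw [← Finset.add_sum_erase _ _ (Finset.mem_univ l), add_eq_zero_iff_eq_neg] at h
    rw [h]
    exact (Ideal.neg_mem_iff _).2 (Ideal.sum_mem _ fun i hi =>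
      Ideal.mul_mem_left _ _ (Ideal.subset_span ⟨i, hi, rfl⟩))
  rw [← homogeneousComponent_eq_self (hc l)]
  refine homogeneousComponent_eq_zero_of_mem_span (m := 2) ?_ h1 hn
  rintro _ ⟨i, -, rfl⟩
  exact hr i

variable [Fintype σ]

/-- The quadratic form with matrix `M`. -/
def quadric (M : σ → σ → ℂ) : MvPolynomial σ ℂ := ∑ a, ∑ b, M a b • (X a * X b)

theorem quadric_isHomogeneous (M : σ → σ → ℂ) : (quadric M).IsHomogeneous 2 := by
  refine IsHomogeneous.sum _ _ _ fun a _ => IsHomogeneous.sum _ _ _ fun b _ => ?_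
  rw [smul_eq_C_mul]
  exact ((isHomogeneous_X ℂ a).mul (isHomogeneous_X ℂ b)).C_mul _

/-- The matrices `M l` need not be symmetric, whereas brackets of generators see `M + Mᵀ`. The
factor two found here cancels the `1/2` in the differential. -/
theorem sum_symm_smul (M : σ → σ → ℂ) {B : Type} [AddCommGroup B] [Module ℂ B] (f : σ → σ → B)
    (hf : ∀ a b, f a b = f b a) :
    ∑ a, ∑ b, (M a b + M b a) • f a b = (2 : ℂ) • ∑ a, ∑ b, M a b • f a b := by
  simp only [add_smul, Finset.sum_add_distrib]
  rw [two_smul]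
  congr 1
  rw [Finset.sum_comm]
  simp only [hf]

end Quadrics

/-! ### Tensors and quadratic polynomials -/

section SymmetricTensors

open MvPolynomial

variable {σ : Type} {W : Type} [AddCommGroup W] [Module ℂ W] (b : Module.Basis σ ℂ W)

/-- The quadratic polynomial defined by a tensor. -/
def tensorPoly : W ⊗[ℂ] W →ₗ[ℂ] MvPolynomial σ ℂ :=
  TensorProduct.lift ((LinearMap.mul ℂ (MvPolynomial σ ℂ)).compl₁₂
    (b.constr ℂ (X : σ → MvPolynomial σ ℂ)) (b.constr ℂ (X : σ → MvPolynomial σ ℂ)))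

theorem tensorPoly_basis (v w : σ) : tensorPoly b (b v ⊗ₜ b w) = X v * X w := by
  simp [tensorPoly]

variable [Fintype σ]

/-- The tensor with matrix `M`. -/
def quadricTensor (M : σ → σ → ℂ) : W ⊗[ℂ] W := ∑ v, ∑ w, M v w • (b v ⊗ₜ[ℂ] b w)

theorem tensorPoly_quadricTensor (M : σ → σ → ℂ) :
    tensorPoly b (quadricTensor b M) = quadric M := by
  simp [quadricTensor, quadric, tensorPoly_basis]

theorem dualDistrib_quadricTensor [DecidableEq σ] (M : σ → σ → ℂ) (v w : σ) :
    TensorProduct.dualDistrib ℂ W W (b.coord v ⊗ₜ b.coord w) (quadricTensor b M) = M v w := by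
  simp [quadricTensor, Finsupp.single_apply]

/-- The polarization of a quadratic polynomial. -/
def polarization : MvPolynomial σ ℂ →ₗ[ℂ] W ⊗[ℂ] W :=
  ∑ v, ∑ w, ((aeval (0 : σ → ℂ)).toLinearMap ∘ₗ (pderiv v).toLinearMap ∘ₗ
    (pderiv w).toLinearMap).smulRight (b v ⊗ₜ[ℂ] b w)

/-- The second derivatives of a quadratic form are constant and recover the symmetrization of the
tensor; hence a tensor with zero polynomial is antisymmetric. -/
theorem polarization_tensorPoly (t : W ⊗[ℂ] W) :
    polarization b (tensorPoly b t) = t + TensorProduct.comm ℂ W W t := by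
  classical
  suffices h : polarization b ∘ₗ tensorPoly b =
      LinearMap.id + (TensorProduct.comm ℂ W W).toLinearMap from LinearMap.congr_fun h t
  refine (b.tensorProduct b).ext fun ⟨c, e⟩ => ?_
  have hs (v w : σ) : aeval (0 : σ → ℂ) (pderiv v (pderiv w (X c * X e : MvPolynomial σ ℂ))) =
      (if v = c then 1 else 0) * (if w = e then 1 else 0) +
        (if v = e then 1 else 0) * (if w = c then (1 : ℂ) else 0) := by
    have hX (v c : σ) : pderiv v (X c : MvPolynomial σ ℂ) = C (if v = c then 1 else 0) := by
      rw [pderiv_X, Pi.single_apply]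
      split_ifs <;> simp_all
    simp only [Derivation.leibniz, hX, smul_eq_mul, map_add, pderiv_C, mul_zero, map_mul,
      aeval_C, Algebra.algebraMap_self, RingHom.id_apply, zero_add]
    ring
  simp only [Module.Basis.tensorProduct_apply, LinearMap.comp_apply, tensorPoly_basis,
    LinearMap.add_apply, LinearMap.id_apply, LinearEquiv.coe_coe, TensorProduct.comm_tmul,
    polarization, LinearMap.sum_apply, LinearMap.smulRight_apply, Derivation.coeFn_coe,
    AlgHom.toLinearMap_apply, hs, add_smul, mul_smul, ite_smul, one_smul, zero_smul,
    Finset.sum_add_distrib]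
  simp

/-- Such a `t` is antisymmetric while `η` is symmetric, so the pairing equals its own negative. -/
theorem dualDistrib_eq_zero {η : Module.Dual ℂ W ⊗[ℂ] Module.Dual ℂ W}
    (hη : TensorProduct.comm ℂ _ _ η = η) {t : W ⊗[ℂ] W} (ht : tensorPoly b t = 0) :
    TensorProduct.dualDistrib ℂ W W η t = 0 := by
  have h := polarization_tensorPoly b t
  rw [ht, map_zero] at h
  have h1 := congrArg (TensorProduct.dualDistrib ℂ W W η) h
  have h2 : TensorProduct.dualDistrib ℂ W W η (TensorProduct.comm ℂ W W t) =
      TensorProduct.dualDistrib ℂ W W η t := by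
    conv_rhs => rw [← hη]
    rw [← TensorProduct.dualDistrib_apply_comm]
  rw [map_zero, map_add, h2, ← two_smul ℂ] at h1
  exact (smul_eq_zero.1 h1.symm).resolve_left two_ne_zero

end SymmetricTensors

/-! ### The quadratic dual in low degrees -/

section DualAlgebra

variable {W : Type} [AddCommGroup W] [Module ℂ W] (R : Submodule ℂ (W ⊗[ℂ] W))

/-- The action of functionals on `ℂ × W × ℂ` determined by a tensor `t`: a composition of two of
them maps the first summand to the last one by evaluation at `t`. -/
def evalAction (t : W ⊗[ℂ] W) : Module.Dual ℂ W →ₗ[ℂ] Module.End ℂ (ℂ × W × ℂ) where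
  toFun ξ := LinearMap.prod 0 (LinearMap.prod
    ((LinearMap.fst ℂ ℂ (W × ℂ)).smulRight (TensorProduct.rid ℂ W (LinearMap.lTensor W ξ t)))
    (ξ ∘ₗ LinearMap.fst ℂ W ℂ ∘ₗ LinearMap.snd ℂ ℂ (W × ℂ)))
  map_add' ξ η := by
    refine LinearMap.ext fun z => ?_
    simp [LinearMap.lTensor_add]
  map_smul' c ξ := by
    refine LinearMap.ext fun z => ?_
    refine Prod.ext (by simp) (Prod.ext ?_ (by simp))
    simp [LinearMap.lTensor_smul, smul_comm c z.1]

theorem apply_rid_lTensor (ξ η : Module.Dual ℂ W) (t : W ⊗[ℂ] W) :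
    ξ (TensorProduct.rid ℂ W (LinearMap.lTensor W η t)) =
      TensorProduct.dualDistrib ℂ W W (ξ ⊗ₜ η) t := by
  induction t using TensorProduct.induction_on with
  | zero => simp
  | tmul a b => simp [mul_comm]
  | add a b ha hb => simp only [map_add, ha, hb]

theorem lift_evalAction (t : W ⊗[ℂ] W) (η : Module.Dual ℂ W ⊗[ℂ] Module.Dual ℂ W)
    (z : ℂ × W × ℂ) :
    TensorProduct.lift ((LinearMap.mul ℂ (Module.End ℂ (ℂ × W × ℂ))).compl₁₂ (evalAction t)
      (evalAction t)) η z = (0, 0, z.1 * TensorProduct.dualDistrib ℂ W W η t) := by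
  induction η using TensorProduct.induction_on with
  | zero => simp; rfl
  | tmul a b => simp [evalAction, apply_rid_lTensor]
  | add a b ha hb => rw [map_add, LinearMap.add_apply, ha, hb]; simp [mul_add]

/-- The functional on the quadratic dual that evaluates products of two generators at a
relation. -/
def evalRelation {t : W ⊗[ℂ] W} (ht : t ∈ R) : QuadraticDual R →ₗ[ℂ] ℂ :=
  -- The action descends to the quadratic dual because elements of `R^⊥` act through their value at
  -- `t ∈ R`, which is zero. The functional is the matrix coefficient from the first summand to the
  -- last.
  LinearMap.snd ℂ W ℂ ∘ₗ LinearMap.snd ℂ ℂ (W × ℂ) ∘ₗ LinearMap.applyₗ (1, 0, 0) ∘ₗ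
    (dualLift (R := R) (evalAction t) fun η hη => LinearMap.ext fun z => by
      rw [lift_evalAction, hη t ht]; simp).toLinearMap

/-- The product of two generators of the quadratic dual. -/
def dualMul : Module.Dual ℂ W ⊗[ℂ] Module.Dual ℂ W →ₗ[ℂ] QuadraticDual R :=
  TensorProduct.lift
    ((LinearMap.mul ℂ (QuadraticDual R)).compl₁₂ (dualGen R) (dualGen R))

theorem dualMul_tmul (ξ η : Module.Dual ℂ W) :
    dualMul R (ξ ⊗ₜ η) = dualGen R ξ * dualGen R η := by
  simp [dualMul]

theorem evalRelation_dualMul {t : W ⊗[ℂ] W} (ht : t ∈ R)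
    (η : Module.Dual ℂ W ⊗[ℂ] Module.Dual ℂ W) :
    evalRelation R ht (dualMul R η) = TensorProduct.dualDistrib ℂ W W η t := by
  induction η using TensorProduct.induction_on with
  | zero => simp
  | tmul a b =>
    rw [dualMul_tmul, ← apply_rid_lTensor]
    simp [evalRelation, dualLift_gen, evalAction]
  | add a b ha hb => simp only [map_add, LinearMap.add_apply, ha, hb]

/-- The supercommutator of two generators of the quadratic dual. -/
def dualSymm : Module.Dual ℂ W ⊗[ℂ] Module.Dual ℂ W →ₗ[ℂ] QuadraticDual R :=
  dualMul R ∘ₗ (LinearMap.id + (TensorProduct.comm ℂ _ _).toLinearMap)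

theorem dualSymm_tmul (ξ η : Module.Dual ℂ W) :
    dualSymm R (ξ ⊗ₜ η) = dualGen R ξ * dualGen R η + dualGen R η * dualGen R ξ := by
  simp [dualSymm, dualMul_tmul]

theorem evalRelation_dualSymm {t : W ⊗[ℂ] W} (ht : t ∈ R)
    (η : Module.Dual ℂ W ⊗[ℂ] Module.Dual ℂ W) :
    evalRelation R ht (dualSymm R η) =
      TensorProduct.dualDistrib ℂ W W (η + TensorProduct.comm ℂ _ _ η) t := by
  rw [← evalRelation_dualMul R ht]
  rfl

theorem superBracket_one_one (ξ η : Module.Dual ℂ W) :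
    superBracket R 1 1 (dualGen R ξ) (dualGen R η) = dualSymm R (ξ ⊗ₜ η) := by
  rw [superBracket_apply, dualSymm_tmul]
  simp

theorem dualSymm_mem_liePart (η : Module.Dual ℂ W ⊗[ℂ] Module.Dual ℂ W) :
    dualSymm R η ∈ liePart R 2 := by
  induction η using TensorProduct.induction_on with
  | zero => simp
  | tmul a b =>
    rw [← superBracket_one_one]
    exact (isLieFamily_liePart R).bracket_mem 1 1 _ _ ((isLieFamily_liePart R).gen_mem a)
      ((isLieFamily_liePart R).gen_mem b)
  | add a b ha hb => rw [map_add]; exact Submodule.add_mem _ ha hb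

/-- If the generators supercommute with their supercommutators, the Lie superalgebra is concentrated
in degrees one and two. -/
theorem liePart_le_of_comm (h : ∀ ξ η, dualGen R ξ * dualSymm R η = dualSymm R η * dualGen R ξ)
    (k : ℕ) : liePart R k ≤ match k with
      | 1 => LinearMap.range (dualGen R)
      | 2 => LinearMap.range (dualSymm R)
      | _ => ⊥ := by
  -- A supercommutator is a sum of products of two generators, each of which commutes with the other
  -- supercommutator.
  have hcomm : ∀ η η', dualSymm R η * dualSymm R η' = dualSymm R η' * dualSymm R η := by
    intro η η'
    induction η using TensorProduct.induction_on with
    | zero => simp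
    | tmul a b =>
      rw [dualSymm_tmul, add_mul, mul_add, mul_assoc, h, ← mul_assoc, h, mul_assoc,
        mul_assoc (dualGen R b), h, ← mul_assoc (dualGen R b), h, mul_assoc]
    | add a b ha hb => rw [map_add, add_mul, mul_add, ha, hb]
  refine liePart_le R (S := fun k => match k with
      | 1 => LinearMap.range (dualGen R)
      | 2 => LinearMap.range (dualSymm R)
      | _ => ⊥) { gen_mem := fun ξ => ⟨ξ, rfl⟩, bracket_mem := ?_ } k
  intro i j x y hx hy
  match i, j, hx, hy with
  | 0, j, hx, hy =>
    rw [(Submodule.mem_bot ℂ).1 hx, map_zero, LinearMap.zero_apply]; exact Submodule.zero_mem _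
  | i + 3, j, hx, hy =>
    rw [(Submodule.mem_bot ℂ).1 hx, map_zero, LinearMap.zero_apply]; exact Submodule.zero_mem _
  | i, 0, hx, hy =>
    rw [(Submodule.mem_bot ℂ).1 hy, map_zero]; exact Submodule.zero_mem _
  | i, j + 3, hx, hy =>
    rw [(Submodule.mem_bot ℂ).1 hy, map_zero]; exact Submodule.zero_mem _
  | 1, 1, ⟨ξ, hξ⟩, ⟨η, hη⟩ =>
    rw [← hξ, ← hη, superBracket_one_one]
    exact ⟨_, rfl⟩
  -- A degree-two factor makes the sign `+1`, so the superbracket is an ordinary commutator.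
  | 1, 2, ⟨ξ, hξ⟩, ⟨η, hη⟩ =>
    rw [← hξ, ← hη, superBracket_apply, h]
    simp
  | 2, 1, ⟨ξ, hξ⟩, ⟨η, hη⟩ =>
    rw [← hξ, ← hη, superBracket_apply, h]
    simp
  | 2, 2, ⟨ξ, hξ⟩, ⟨η, hη⟩ =>
    rw [← hξ, ← hη, superBracket_apply, hcomm]
    norm_num

/-- Degree zero is trivial, so degree two arises only as `1 + 1`. Nothing is claimed from degree
three on, which makes this available before the vanishing of `[L₁, L₂]` is known. -/
theorem liePart_le_low (k : ℕ) : liePart R k ≤ match k with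
      | 1 => LinearMap.range (dualGen R)
      | 2 => LinearMap.range (dualSymm R)
      | 0 => ⊥
      | _ => ⊤ := by
  refine liePart_le R (S := fun k => match k with
      | 1 => LinearMap.range (dualGen R)
      | 2 => LinearMap.range (dualSymm R)
      | 0 => ⊥
      | _ => ⊤) { gen_mem := fun ξ => ⟨ξ, rfl⟩, bracket_mem := ?_ } k
  intro i j x y hx hy
  match i, j, hx, hy with
  | 0, j, hx, hy =>
    rw [(Submodule.mem_bot ℂ).1 hx, map_zero, LinearMap.zero_apply]; exact Submodule.zero_mem _
  | i, 0, hx, hy =>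
    rw [(Submodule.mem_bot ℂ).1 hy, map_zero]; exact Submodule.zero_mem _
  | 1, 1, ⟨ξ, hξ⟩, ⟨η, hη⟩ =>
    rw [← hξ, ← hη, superBracket_one_one]
    exact ⟨_, rfl⟩
  | i + 2, j + 1, _, _ =>
    rw [show i + 2 + (j + 1) = i + j + 3 by ring]
    exact Submodule.mem_top
  | i + 1, j + 2, _, _ =>
    rw [show i + 1 + (j + 2) = i + j + 3 by ring]
    exact Submodule.mem_top

theorem exists_dualSymm_eq (z : liePart R 2) : ∃ η, dualSymm R η = z :=
  liePart_le_low R 2 z.2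

variable {R} {σ ι : Type} [Fintype σ] (b : Module.Basis σ ℂ W) {M : ι → σ → σ → ℂ}
  (hR : ∀ t, t ∈ R ↔ tensorPoly b t ∈ Submodule.span ℂ (Set.range fun l => quadric (M l)))

include hR

theorem quadricTensor_mem (l : ι) : quadricTensor b (M l) ∈ R := by
  rw [hR, tensorPoly_quadricTensor]
  exact Submodule.subset_span ⟨l, rfl⟩

/-- A supercommutator of generators is determined by its values on the relations. -/
theorem dualSymm_eq_zero [Fintype ι] {η : Module.Dual ℂ W ⊗[ℂ] Module.Dual ℂ W}
    (h : ∀ l, evalRelation R (quadricTensor_mem b hR l) (dualSymm R η) = 0) :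
    dualSymm R η = 0 := by
  refine lift_dualGen R (η := η + TensorProduct.comm ℂ _ _ η) fun t ht => ?_
  obtain ⟨c, hc⟩ := (Submodule.mem_span_range_iff_exists_fun ℂ).1 ((hR t).1 ht)
  -- A relation differs from a combination of the tensors of the `M l` by a tensor with zero
  -- polynomial, invisible to the symmetric functional `η + comm η`.
  have h1 : tensorPoly b (t - ∑ l, c l • quadricTensor b (M l)) = 0 := by
    rw [map_sub, map_sum, ← hc, sub_eq_zero]
    simp only [map_smul, tensorPoly_quadricTensor]
  have hcomm : TensorProduct.comm ℂ _ _ (η + TensorProduct.comm ℂ _ _ η) =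
      η + TensorProduct.comm ℂ _ _ η := by
    rw [map_add, TensorProduct.comm_comm, add_comm]
  have h2 := dualDistrib_eq_zero b hcomm h1
  rw [map_sub, sub_eq_zero, map_sum] at h2
  rw [h2]
  refine Finset.sum_eq_zero fun l _ => ?_
  rw [map_smul, ← evalRelation_dualSymm R (quadricTensor_mem b hR l), h, smul_zero]

/-- The pairing of the degree two component of the Lie superalgebra with the relations. -/
def lieTwoPairing : liePart R 2 →ₗ[ℂ] ι → ℂ :=
  LinearMap.pi fun l => evalRelation R (quadricTensor_mem b hR l) ∘ₗ (liePart R 2).subtype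

theorem lieTwoPairing_dualSymm [DecidableEq σ] (v w : σ) (l : ι) :
    lieTwoPairing b hR ⟨dualSymm R (b.coord v ⊗ₜ b.coord w), dualSymm_mem_liePart R _⟩ l =
      M l v w + M l w v := by
  simp only [lieTwoPairing, LinearMap.pi_apply, LinearMap.comp_apply, Submodule.subtype_apply,
    evalRelation_dualSymm, TensorProduct.comm_tmul, map_add, LinearMap.add_apply,
    dualDistrib_quadricTensor]

theorem lieTwoPairing_injective [Fintype ι] : Function.Injective (lieTwoPairing b hR) := by
  refine (injective_iff_map_eq_zero _).2 fun z hz => Subtype.ext ?_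
  obtain ⟨η, hη⟩ := exists_dualSymm_eq R z
  rw [← hη]
  refine dualSymm_eq_zero b hR fun l => ?_
  rw [hη]
  exact congrFun hz l

/-- A functional vanishing on the image is a linear dependence between the symmetrized matrices `M
l`, hence between the quadrics: a syzygy of degree zero. -/
theorem lieTwoPairing_surjective [Fintype ι] (hreg : IsRegularFamily fun l => quadric (M l)) :
    Function.Surjective (lieTwoPairing b hR) := by
  classical
  by_contra hs
  obtain ⟨f, hf0, hf⟩ := (LinearMap.range (lieTwoPairing b hR)).exists_le_ker_of_lt_top
    (lt_top_iff_ne_top.2 (mt LinearMap.range_eq_top.1 hs))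
  have hfc (g : ι → ℂ) : f g = ∑ l, g l * f (Pi.single l 1) := by
    conv_lhs => rw [← Finset.univ_sum_single g, map_sum]
    refine Finset.sum_congr rfl fun l _ => ?_
    rw [← smul_eq_mul, ← map_smul, ← Pi.single_smul, smul_eq_mul, mul_one]
  have hsum (v w : σ) : ∑ l, (M l v w + M l w v) * f (Pi.single l 1) = 0 := by
    have := hf ⟨_, rfl⟩ (x := lieTwoPairing b hR
      ⟨dualSymm R (b.coord v ⊗ₜ b.coord w), dualSymm_mem_liePart R _⟩)
    rw [LinearMap.mem_ker, hfc] at this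
    simpa only [lieTwoPairing_dualSymm] using this
  refine hf0 (LinearMap.ext fun g => ?_)
  rw [hfc, LinearMap.zero_apply]
  refine Finset.sum_eq_zero fun l _ => ?_
  have key : ∑ l, MvPolynomial.C (f (Pi.single l 1)) * quadric (M l) = 0 := by
    have h2 : (2 : ℂ) • ∑ l, MvPolynomial.C (f (Pi.single l 1)) * quadric (M l) = 0 := by
      have h3 : (2 : ℂ) • ∑ l, MvPolynomial.C (f (Pi.single l 1)) * quadric (M l) =
          ∑ l, f (Pi.single l 1) • ∑ v, ∑ w, (M l v w + M l w v) •
            (MvPolynomial.X v * MvPolynomial.X w : MvPolynomial σ ℂ) := by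
        rw [Finset.smul_sum]
        refine Finset.sum_congr rfl fun l _ => ?_
        rw [sum_symm_smul _ _ fun v w => mul_comm _ _, smul_comm, MvPolynomial.smul_eq_C_mul _
          (f _ : ℂ), quadric]
      rw [h3]
      simp only [Finset.smul_sum, smul_smul]
      rw [Finset.sum_comm]
      refine Finset.sum_eq_zero fun v _ => ?_
      rw [Finset.sum_comm]
      refine Finset.sum_eq_zero fun w _ => ?_
      rw [← Finset.sum_smul]
      simp only [mul_comm (f _)]
      rw [hsum, zero_smul]
    exact (smul_eq_zero.1 h2).resolve_left two_ne_zero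
  have := hreg.eq_zero_of_syzygy (fun l => quadric_isHomogeneous (M l)) (n := 0) (by norm_num)
    (fun l => MvPolynomial.isHomogeneous_C _ _) key l
  rw [MvPolynomial.C_eq_zero.1 this, mul_zero]

end DualAlgebra

/-! ### Vanishing in degree three and the cohomology of the dual Lie superalgebra -/

section DualLie

open MvPolynomial

variable {W : Type} [AddCommGroup W] [Module ℂ W] {R : Submodule ℂ (W ⊗[ℂ] W)}
  {σ ι : Type} [Fintype σ] [Fintype ι] (b : Module.Basis σ ℂ W) {M : ι → σ → σ → ℂ}
  (hR : ∀ t, t ∈ R ↔ tensorPoly b t ∈ Submodule.span ℂ (Set.range fun l => quadric (M l)))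
  (hreg : IsRegularFamily fun l => quadric (M l))

/-- The basis of the degree two component of the Lie superalgebra dual to the relations. -/
def lieTwoBasis : Module.Basis ι ℂ (liePart R 2) :=
  Module.Basis.ofEquivFun (LinearEquiv.ofBijective (lieTwoPairing b hR)
    ⟨lieTwoPairing_injective b hR, lieTwoPairing_surjective b hR hreg⟩)

theorem lieTwoBasis_repr [DecidableEq σ] (v w : σ) (l : ι) :
    (lieTwoBasis b hR hreg).repr
      ⟨dualSymm R (b.coord v ⊗ₜ b.coord w), dualSymm_mem_liePart R _⟩ l = M l v w + M l w v := by
  rw [lieTwoBasis, Module.Basis.ofEquivFun_repr_apply]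
  exact lieTwoPairing_dualSymm b hR v w l

theorem dualSymm_eq_sum [DecidableEq σ] (v w : σ) :
    dualSymm R (b.coord v ⊗ₜ b.coord w) =
      ∑ l, (M l v w + M l w v) • (lieTwoBasis b hR hreg l : QuadraticDual R) := by
  have := congrArg Subtype.val ((lieTwoBasis b hR hreg).sum_repr
    ⟨dualSymm R (b.coord v ⊗ₜ b.coord w), dualSymm_mem_liePart R _⟩)
  simp only [lieTwoBasis_repr] at this
  rw [← this]
  simp

/-- The Jacobi identity for three odd elements, where all signs are positive. -/
theorem superBracket_cyclic (ξ η ζ : Module.Dual ℂ W) :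
    superBracket R 1 2 (dualGen R ξ) (dualSymm R (η ⊗ₜ ζ)) +
      superBracket R 1 2 (dualGen R η) (dualSymm R (ζ ⊗ₜ ξ)) +
      superBracket R 1 2 (dualGen R ζ) (dualSymm R (ξ ⊗ₜ η)) = 0 := by
  simp only [superBracket_apply, dualSymm_tmul]
  norm_num
  noncomm_ring

/-- The cubic monomials are invariant under rotating the indices, so three times the sum is the sum
with cyclically symmetrized coefficients. -/
theorem sum_smul_X_eq_zero_of_cyclic (f : σ → σ → σ → ℂ)
    (hf : ∀ u v w, f u v w + f v w u + f w u v = 0) :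
    ∑ u, ∑ v, ∑ w, f u v w • (X u * (X v * X w) : MvPolynomial σ ℂ) = 0 := by
  set T := ∑ u, ∑ v, ∑ w, f u v w • (X u * (X v * X w) : MvPolynomial σ ℂ) with hT
  have h1 : T = ∑ u, ∑ v, ∑ w, f v w u • (X u * (X v * X w) : MvPolynomial σ ℂ) := by
    rw [hT, Finset.sum_comm_cycle]
    refine Finset.sum_congr rfl fun u _ => Finset.sum_congr rfl fun v _ =>
      Finset.sum_congr rfl fun w _ => ?_
    congr 1
    ring
  have h2 : T = ∑ u, ∑ v, ∑ w, f w u v • (X u * (X v * X w) : MvPolynomial σ ℂ) := by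
    rw [h1, Finset.sum_comm_cycle]
    refine Finset.sum_congr rfl fun u _ => Finset.sum_congr rfl fun v _ =>
      Finset.sum_congr rfl fun w _ => ?_
    congr 1
    ring
  have h3 : T + T + T = 0 := by
    conv_lhs => enter [2]; rw [h2]
    conv_lhs => enter [1, 2]; rw [h1]
    rw [hT]
    simp only [← Finset.sum_add_distrib, ← add_smul, hf, zero_smul, Finset.sum_const_zero]
  have h4 : (3 : ℂ) • T = 0 := by rw [← h3]; module
  exact (smul_eq_zero.1 h4).resolve_left (by norm_num)

/-- For a functional `φ`, the linear forms `∑ u, φ [ξ_u, y_l] X u` are, by the Jacobi identity, the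
coefficients of a syzygy of the quadrics. Linear syzygies vanish, and functionals separate points.
-/
theorem superBracket_lieTwoBasis [DecidableEq σ] (u : σ) (l : ι) :
    superBracket R 1 2 (dualGen R (b.coord u)) (lieTwoBasis b hR hreg l) = 0 := by
  refine (Module.forall_dual_apply_eq_zero_iff ℂ _).1 fun φ => ?_
  set g : ι → σ → ℂ := fun l u =>
    φ (superBracket R 1 2 (dualGen R (b.coord u)) (lieTwoBasis b hR hreg l))
  have hcyc := sum_smul_X_eq_zero_of_cyclic (fun u v w =>
      φ (superBracket R 1 2 (dualGen R (b.coord u)) (dualSymm R (b.coord v ⊗ₜ b.coord w))))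
    fun u v w => by
      rw [← map_add, ← map_add, superBracket_cyclic, map_zero]
  simp only [dualSymm_eq_sum b hR hreg, map_sum, map_smul, Finset.sum_smul] at hcyc
  have key : ∑ l, (∑ u, g l u • X u) * quadric (M l) = 0 := by
    -- The factor two appears because `[ξ_v, ξ_w]` expands with the coefficients of `M l + (M l)ᵀ`.
    have h2 : (2 : ℂ) • ∑ l, (∑ u, g l u • X u) * quadric (M l) = 0 := by
      rw [← hcyc, Finset.smul_sum]
      calc _ = ∑ l, (∑ u, g l u • X u) * ∑ v, ∑ w, (M l v w + M l w v) •
            (X v * X w : MvPolynomial σ ℂ) := by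
            refine Finset.sum_congr rfl fun l _ => ?_
            rw [sum_symm_smul _ _ fun v w => mul_comm _ _, mul_smul_comm, quadric]
        _ = ∑ l, ∑ u, ∑ v, ∑ w, ((M l v w + M l w v) • g l u) •
            (X u * (X v * X w) : MvPolynomial σ ℂ) := by
            refine Finset.sum_congr rfl fun l _ => ?_
            rw [Finset.sum_mul]
            refine Finset.sum_congr rfl fun u _ => ?_
            rw [Finset.mul_sum]
            refine Finset.sum_congr rfl fun v _ => ?_
            rw [Finset.mul_sum]
            refine Finset.sum_congr rfl fun w _ => ?_
            rw [smul_mul_smul_comm, smul_eq_mul, mul_comm (g l u)]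
        _ = _ := by
            rw [Finset.sum_comm]
            refine Finset.sum_congr rfl fun u _ => ?_
            rw [Finset.sum_comm]
            refine Finset.sum_congr rfl fun v _ => ?_
            rw [Finset.sum_comm]
    exact (smul_eq_zero.1 h2).resolve_left two_ne_zero
  have hlin (l : ι) : (∑ u, g l u • X u : MvPolynomial σ ℂ).IsHomogeneous 1 := by
    refine IsHomogeneous.sum _ _ _ fun u _ => ?_
    rw [smul_eq_C_mul]
    exact (isHomogeneous_X ℂ u).C_mul _
  have h0 := hreg.eq_zero_of_syzygy (fun l => quadric_isHomogeneous (M l)) (n := 1) (by norm_num)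
    hlin key l
  have h1 := congrArg (coeff (Finsupp.single u 1)) h0
  simpa [coeff_sum, coeff_X, Finsupp.single_left_inj] using h1

include hreg hR in
theorem dualGen_mul_dualSymm (ξ : Module.Dual ℂ W) (η : Module.Dual ℂ W ⊗[ℂ] Module.Dual ℂ W) :
    dualGen R ξ * dualSymm R η = dualSymm R η * dualGen R ξ := by
  classical
  suffices h : superBracket R 1 2 (dualGen R ξ) (dualSymm R η) = 0 by
    rw [superBracket_apply] at h
    norm_num at h
    exact sub_eq_zero.1 h
  have e := congrArg Subtype.val ((lieTwoBasis b hR hreg).sum_repr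
    ⟨dualSymm R η, dualSymm_mem_liePart R _⟩)
  simp only [AddSubmonoidClass.coe_finsetSum, Submodule.coe_smul] at e
  rw [← e, map_sum, ← b.sum_dual_apply_smul_coord ξ, map_sum, map_sum]
  refine Finset.sum_eq_zero fun l _ => ?_
  rw [LinearMap.sum_apply]
  refine Finset.sum_eq_zero fun v _ => ?_
  rw [map_smul, map_smul, map_smul, LinearMap.smul_apply, superBracket_lieTwoBasis b hR hreg,
    smul_zero, smul_zero]

variable [FiniteDimensional ℂ W]

/-- The basis of the degree one component of the Lie superalgebra dual to a basis of `W`. -/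
def lieOneBasis [DecidableEq σ] : Module.Basis σ ℂ ((dualLie R).comp 1) :=
  b.dualBasis.map (LinearEquiv.ofBijective (lieGen R)
    -- The projection `degreeOne` is a left inverse; surjectivity is the degree-one case of
    -- `liePart_le_low`.
    ⟨fun ξ η h => by
      rw [← degreeOne_gen R ξ, ← degreeOne_gen R η, ← lieIncl_lieGen, h, lieIncl_lieGen],
    fun z => by
      obtain ⟨ξ, hξ⟩ := liePart_le_low R 1 (Subtype.prop z : _ ∈ liePart R 1)
      exact ⟨ξ, lieIncl_injective R 1 hξ⟩⟩)

theorem lieOneBasis_apply [DecidableEq σ] (v : σ) :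
    lieOneBasis (R := R) b v = lieGen R (b.coord v) := by
  rw [lieOneBasis, Module.Basis.map_apply, Module.Basis.coe_dualBasis]
  rfl

/-- This matches the variables of the polynomial ring with elements of `W` as functions on `L₁`, as
the compatibility in degree one requires. -/
theorem coord_lieOneBasis [DecidableEq σ] (v : σ) :
    (lieOneBasis (R := R) b).coord v = evalOne R (b v) := by
  refine (lieOneBasis (R := R) b).ext fun w => ?_
  rw [Module.Basis.coord_apply, Module.Basis.repr_self, lieOneBasis_apply]
  simp only [evalOne, LinearMap.comp_apply, lieIncl_lieGen, degreeOne_gen, Module.Dual.eval_apply]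
  simp [Finsupp.single_apply, eq_comm]

include hreg hR in
/-- The Chevalley-Eilenberg cohomology of the Lie superalgebra dual to a regular family of
quadrics. -/
theorem exists_dualLie_cohomology_equiv {I : Ideal (MvPolynomial σ ℂ)}
    (hI : I = Ideal.span (Set.range fun l => quadric (M l))) :
    ∃ e : (MvPolynomial σ ℂ ⧸ I) ≃ₐ[ℂ] Cohomology (dualLie R), ∀ v,
      e (Ideal.Quotient.mk I (X v)) = classOne R (b v) := by
  classical
  have hlow : ∀ k, k ≠ 1 → k ≠ 2 → ∀ z : (dualLie R).comp k, z = 0 := by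
    intro k h1 h2 z
    have := liePart_le_of_comm R (dualGen_mul_dualSymm b hR hreg) k (Subtype.prop z : _ ∈ liePart R k)
    refine lieIncl_injective R k ?_
    rw [map_zero]
    match k, h1, h2, z, this with
    | 0, _, _, z, h => exact h
    | k + 3, _, _, z, h => exact h
  let y : Module.Basis ι ℂ ((dualLie R).comp 2) := lieTwoBasis b hR hreg
  have hy (v w : σ) (l : ι) : y.coord l ((dualLie R).bracket (show 1 + 1 = 2 from rfl)
      (lieOneBasis b v) (lieOneBasis b w)) = M l v w + M l w v := by
    have e : (dualLie R).bracket (show 1 + 1 = 2 from rfl) (lieOneBasis b v) (lieOneBasis b w) =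
        (⟨dualSymm R (b.coord v ⊗ₜ b.coord w), dualSymm_mem_liePart R _⟩ : liePart R 2) := by
      rw [lieOneBasis_apply, lieOneBasis_apply]
      exact Subtype.ext (superBracket_one_one R _ _)
    rw [e]
    exact lieTwoBasis_repr b hR hreg v w l
  have h0 := hlow 0 (by norm_num) (by norm_num)
  obtain ⟨e, he⟩ := exists_cohomology_equiv (L := dualLie R) (x := lieOneBasis b) (y := y)
    (r := fun l => quadric (M l)) h0 (fun l => by
      rw [d_gen, dGen_two _ (lieOneBasis b) h0]
      simp only [hy]
      -- Degree-one coordinates commute, so symmetrization doubles the quadric; `-(1/2) * 2 = -1`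
      -- gives the sign of the Koszul differential.
      rw [sum_symm_smul _ _ fun v w => by rw [← polyHom_X, mul_polyHom], smul_smul, quadric]
      simp only [map_sum, map_smul, map_mul, polyHom_X]
      norm_num) hreg hlow hI
  refine ⟨e, fun v => ?_⟩
  rw [he, classOne]
  congr 2
  rw [polyHom_X, coord_lieOneBasis]

end DualLie

/-! ### Gradings of quotients by homogeneous ideals -/

section GradedQuotient

open MvPolynomial

variable {σ : Type} (I : Ideal (MvPolynomial σ ℂ))

/-- The grading by degree of a quotient of the polynomial ring. -/
def quotientGrading (k : ℕ) : Submodule ℂ (MvPolynomial σ ℂ ⧸ I) :=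
  (homogeneousSubmodule σ ℂ k).map (Ideal.Quotient.mkₐ ℂ I).toLinearMap

theorem mk_mem_quotientGrading {p : MvPolynomial σ ℂ} {k : ℕ} (hp : p.IsHomogeneous k) :
    Ideal.Quotient.mk I p ∈ quotientGrading I k := ⟨p, hp, rfl⟩

instance : SetLike.GradedMonoid (quotientGrading I) where
  one_mem := ⟨1, isHomogeneous_one σ ℂ, map_one (Ideal.Quotient.mkₐ ℂ I)⟩
  mul_mem := by
    rintro i j _ _ ⟨p, hp, rfl⟩ ⟨q, hq, rfl⟩
    exact ⟨p * q, IsHomogeneous.mul hp hq, map_mul (Ideal.Quotient.mkₐ ℂ I) p q⟩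

attribute [local instance] MvPolynomial.gradedAlgebra

variable {I} in
-- The decomposition of polynomials into components, followed by reduction modulo `I`, kills `I` by
-- homogeneity and so descends to the quotient.
theorem nonempty_gradedAlgebra (hI : I.IsHomogeneous (homogeneousSubmodule σ ℂ)) :
    Nonempty (GradedAlgebra (quotientGrading I)) := by
  let f (i : ℕ) : homogeneousSubmodule σ ℂ i →ₗ[ℂ] quotientGrading I i :=
    (Ideal.Quotient.mkₐ ℂ I).toLinearMap.submoduleMap _
  let G : MvPolynomial σ ℂ →ₗ[ℂ] ⨁ i, quotientGrading I i :=
    DirectSum.lmap f ∘ₗ (DirectSum.decomposeLinearEquiv (homogeneousSubmodule σ ℂ)).toLinearMap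
  have hG : ∀ p ∈ I, G p = 0 := by
    intro p hp
    refine DFinsupp.ext fun i => Subtype.ext ?_
    exact Ideal.Quotient.eq_zero_iff_mem.2 (hI i hp)
  have hcoe : ∀ z, DirectSum.coeAddMonoidHom (quotientGrading I) (DirectSum.lmap f z) =
      Ideal.Quotient.mk I (DirectSum.coeAddMonoidHom (homogeneousSubmodule σ ℂ) z) := by
    intro z
    induction z using DirectSum.induction_on with
    | zero => simp
    | of i x =>
      rw [DirectSum.lmap_of, DirectSum.coeAddMonoidHom_of, DirectSum.coeAddMonoidHom_of]
      rfl
    | add a b ha hb => simp only [map_add, ha, hb]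
  -- The decomposition is computed on a chosen representative; the choice does not matter because
  -- `G` kills `I`.
  have hmk : ∀ p, G (Function.surjInv Ideal.Quotient.mk_surjective (Ideal.Quotient.mk I p)) =
      G p := by
    intro p
    set a := Function.surjInv Ideal.Quotient.mk_surjective (Ideal.Quotient.mk I p)
    have h : G a = G (a - p) + G p := by rw [← map_add, sub_add_cancel]
    rw [h, hG _ (Ideal.Quotient.eq.1 (Function.surjInv_eq Ideal.Quotient.mk_surjective _)),
      zero_add]
  refine ⟨{ decompose' := fun x => G (Function.surjInv Ideal.Quotient.mk_surjective x),
            left_inv := fun x => ?_, right_inv := fun z => ?_ }⟩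
  · obtain ⟨p, rfl⟩ := Ideal.Quotient.mk_surjective x
    refine (congrArg _ (hmk p)).trans ((hcoe _).trans ?_)
    congr 1
    exact (DirectSum.decompose (homogeneousSubmodule σ ℂ)).left_inv p
  · obtain ⟨z', rfl⟩ := (DirectSum.lmap_surjective f).2
      (fun i => LinearMap.submoduleMap_surjective _ _) z
    rw [hcoe]
    refine (hmk _).trans (congrArg (DirectSum.lmap f) ?_)
    exact (DirectSum.decompose (homogeneousSubmodule σ ℂ)).right_inv z'

end GradedQuotient

/-! ### Tensor algebras modulo quadratic relations -/

section TensorQuotient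

open MvPolynomial

variable {σ W : Type} [AddCommGroup W] [Module ℂ W] (b : Module.Basis σ ℂ W)
  (R : Submodule ℂ (W ⊗[ℂ] W))

/-- The two-sided ideal of the tensor algebra generated by a space of quadratic relations. -/
abbrev relationTensorIdeal : TwoSidedIdeal (TensorAlgebra ℂ W) :=
  TwoSidedIdeal.span (tensorSquare W '' (R : Set (W ⊗[ℂ] W)))

/-- The quotient of the tensor algebra by quadratic relations that contain the commutators is a
quotient of the polynomial algebra. -/
theorem exists_hom_of_commutators_mem (hR : ∀ w w' : W, w ⊗ₜ[ℂ] w' - w' ⊗ₜ[ℂ] w ∈ R) :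
    ∃ G : MvPolynomial σ ℂ →ₐ[ℂ] (relationTensorIdeal R).ringCon.Quotient,
      ∀ v, G (X v) = (relationTensorIdeal R).ringCon.mkₐ ℂ (TensorAlgebra.ι ℂ (b v)) := by
  set q : TensorAlgebra ℂ W →ₐ[ℂ] (relationTensorIdeal R).ringCon.Quotient :=
    (relationTensorIdeal R).ringCon.mkₐ ℂ
  have hcomm (w w' : W) : q (TensorAlgebra.ι ℂ w) * q (TensorAlgebra.ι ℂ w') =
      q (TensorAlgebra.ι ℂ w') * q (TensorAlgebra.ι ℂ w) := by
    rw [← map_mul q, ← map_mul q]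
    refine (RingCon.eq _).2 ((TwoSidedIdeal.rel_iff _ _ _).2
      (TwoSidedIdeal.subset_span ⟨w ⊗ₜ w' - w' ⊗ₜ w, hR w w', ?_⟩))
    simp [tensorSquare]
  -- The quotient is not known to be a commutative ring, so evaluation of polynomials again goes
  -- through the centre.
  have hcenter (v : σ) : q (TensorAlgebra.ι ℂ (b v)) ∈
      Subalgebra.center ℂ (relationTensorIdeal R).ringCon.Quotient := by
    refine Subalgebra.mem_center_iff.2 fun z => ?_
    obtain ⟨a, rfl⟩ : ∃ a, q a = z :=
      RingCon.mkₐ_surjective (α := ℂ) (relationTensorIdeal R).ringCon z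
    induction a using TensorAlgebra.induction with
    | algebraMap c => rw [AlgHom.commutes, Algebra.commutes]
    | ι w => exact hcomm _ _
    | mul a b ha hb => rw [map_mul, mul_assoc, hb, ← mul_assoc, ha, mul_assoc]
    | add a b ha hb => rw [map_add, mul_add, add_mul, ha, hb]
  exact ⟨(Subalgebra.center ℂ (relationTensorIdeal R).ringCon.Quotient).val.comp
    (aeval fun v => ⟨q (TensorAlgebra.ι ℂ (b v)), hcenter v⟩), fun v => by simp⟩

/-- On basis tensors `G ∘ tensorPoly` agrees with the projection of the tensor square to the
quotient, where `R` becomes zero. -/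
theorem tensorPoly_eq_zero (G : MvPolynomial σ ℂ →ₐ[ℂ] (relationTensorIdeal R).ringCon.Quotient)
    (hG : ∀ v, G (X v) = (relationTensorIdeal R).ringCon.mkₐ ℂ (TensorAlgebra.ι ℂ (b v)))
    {t : W ⊗[ℂ] W} (ht : t ∈ R) : G (tensorPoly b t) = 0 := by
  have h : G.toLinearMap ∘ₗ tensorPoly b =
      ((relationTensorIdeal R).ringCon.mkₐ ℂ).toLinearMap ∘ₗ tensorSquare W := by
    refine (b.tensorProduct b).ext fun ⟨v, w⟩ => ?_
    rw [Module.Basis.tensorProduct_apply, LinearMap.comp_apply, LinearMap.comp_apply,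
      tensorPoly_basis, AlgHom.toLinearMap_apply, AlgHom.toLinearMap_apply, map_mul, hG, hG, ← map_mul]
    congr 1
  refine (LinearMap.congr_fun h t).trans ((RingCon.eq _).2 ?_)
  exact TwoSidedIdeal.subset_span ⟨t, ht, rfl⟩

end TensorQuotient

/-- The cohomology class of an element of degree one depends linearly on it. -/
def classOneLinear {W : Type} [AddCommGroup W] [Module ℂ W] (R : Submodule ℂ (W ⊗[ℂ] W))
    [FiniteDimensional ℂ W] : W →ₗ[ℂ] Cohomology (dualLie R) where
  toFun := classOne R
  map_add' v w := by
    have h : evalOne R (v + w) = evalOne R v + evalOne R w := by simp [evalOne, LinearMap.add_comp]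
    refine congrArg (Ideal.Quotient.mk (coboundaries (dualLie R))) (Subtype.ext ?_)
    change gen _ 1 (evalOne R (v + w)) = gen _ 1 (evalOne R v) + gen _ 1 (evalOne R w)
    rw [h, map_add]
  map_smul' c w := by
    have h : evalOne R (c • w) = c • evalOne R w := by simp [evalOne, LinearMap.smul_comp]
    refine congrArg (Ideal.Quotient.mk (coboundaries (dualLie R))) (Subtype.ext ?_)
    change gen _ 1 (evalOne R (c • w)) = c • gen _ 1 (evalOne R w)
    rw [h, map_smul]

/-! ### Quotients by quadrics: quadraticity and Koszulness -/

section QuadraticQuotient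

open MvPolynomial

variable {σ ι : Type} [Fintype σ] {M : ι → σ → σ → ℂ} {I : Ideal (MvPolynomial σ ℂ)}
  (hI : I = Ideal.span (Set.range fun l => quadric (M l)))

include hI

theorem homogeneousComponent_eq_zero_of_mem {p : MvPolynomial σ ℂ} (hp : p ∈ I) {k : ℕ}
    (hk : k < 2) : homogeneousComponent k p = 0 := by
  rw [hI] at hp
  refine homogeneousComponent_eq_zero_of_mem_span ?_ hp hk
  rintro _ ⟨l, rfl⟩
  exact quadric_isHomogeneous _

/-- For degree reasons, a degree-two element of the ideal needs only constant coefficients in front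
of the quadrics. -/
theorem mem_iff_of_isHomogeneous {p : MvPolynomial σ ℂ} (hp : p.IsHomogeneous 2) :
    p ∈ I ↔ p ∈ Submodule.span ℂ (Set.range fun l => quadric (M l)) := by
  rw [hI]
  constructor
  · intro h
    rw [← homogeneousComponent_eq_self hp]
    refine homogeneousComponent_mem_span ?_ h
    rintro _ ⟨l, rfl⟩
    exact quadric_isHomogeneous _
  · intro h
    exact Submodule.span_le_restrictScalars ℂ (MvPolynomial σ ℂ) _ h

/-- The classes of the variables form a basis of the component of degree one. -/
def varBasis : Module.Basis σ ℂ (quotientGrading I 1) :=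
  Module.Basis.mk (v := fun v => ⟨Ideal.Quotient.mk I (X v),
      mk_mem_quotientGrading I (isHomogeneous_X ℂ v)⟩)
    (Fintype.linearIndependent_iff.2 fun g hg v => by
      have h1 : (∑ w, g w • X w : MvPolynomial σ ℂ) ∈ I := by
        refine Ideal.Quotient.eq_zero_iff_mem.1 (Eq.trans ?_ (congrArg Subtype.val hg))
        rw [map_sum]
        simp only [AddSubmonoidClass.coe_finsetSum, Submodule.coe_smul]
        rfl
      have h2 : (∑ w, g w • X w : MvPolynomial σ ℂ).IsHomogeneous 1 :=
        IsHomogeneous.sum _ _ _ fun w _ => by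
          rw [smul_eq_C_mul]
          exact (isHomogeneous_X ℂ w).C_mul _
      -- An ideal generated by quadrics contains no nonzero linear form.
      have h3 := homogeneousComponent_eq_zero_of_mem hI h1 (k := 1) (by norm_num)
      rw [homogeneousComponent_eq_self h2] at h3
      classical
      simpa [coeff_sum, coeff_X, Finsupp.single_left_inj] using
        congrArg (coeff (Finsupp.single v 1)) h3)
    (by
      rintro ⟨_, p, hp, rfl⟩ -
      rw [homogeneousSubmodule_one_eq_span_X, SetLike.mem_coe,
        Submodule.mem_span_range_iff_exists_fun] at hp
      obtain ⟨c, rfl⟩ := hp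
      rw [Submodule.mem_span_range_iff_exists_fun]
      refine ⟨c, Subtype.ext ?_⟩
      simp only [AddSubmonoidClass.coe_finsetSum, Submodule.coe_smul, map_sum, map_smul]
      rfl)

theorem coe_varBasis (v : σ) : (varBasis hI v : MvPolynomial σ ℂ ⧸ I) = Ideal.Quotient.mk I (X v) := by
  rw [varBasis, Module.Basis.mk_apply]

theorem lift_mul_eq_mk_tensorPoly (t : quotientGrading I 1 ⊗[ℂ] quotientGrading I 1) :
    TensorProduct.lift ((LinearMap.mul ℂ (MvPolynomial σ ℂ ⧸ I)).compl₁₂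
      (quotientGrading I 1).subtype (quotientGrading I 1).subtype) t =
        Ideal.Quotient.mk I (tensorPoly (varBasis hI) t) := by
  suffices h : TensorProduct.lift ((LinearMap.mul ℂ (MvPolynomial σ ℂ ⧸ I)).compl₁₂
      (quotientGrading I 1).subtype (quotientGrading I 1).subtype) =
        (Ideal.Quotient.mkₐ ℂ I).toLinearMap ∘ₗ tensorPoly (varBasis hI) from
    LinearMap.congr_fun h t
  refine ((varBasis hI).tensorProduct (varBasis hI)).ext fun ⟨v, w⟩ => ?_
  simp [tensorPoly_basis, coe_varBasis]

theorem tensorPoly_isHomogeneous (t : quotientGrading I 1 ⊗[ℂ] quotientGrading I 1) :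
    (tensorPoly (varBasis hI) t).IsHomogeneous 2 := by
  have : LinearMap.range (tensorPoly (varBasis hI)) ≤ homogeneousSubmodule σ ℂ 2 := by
    rw [LinearMap.range_eq_map, ← ((varBasis hI).tensorProduct (varBasis hI)).span_eq,
      Submodule.map_span_le]
    rintro _ ⟨⟨v, w⟩, rfl⟩
    rw [Module.Basis.tensorProduct_apply, tensorPoly_basis]
    exact (isHomogeneous_X ℂ v).mul (isHomogeneous_X ℂ w)
  exact this ⟨t, rfl⟩

/-- This is the hypothesis `hR` under which the quadratic dual was analysed. -/
theorem mem_quadraticRelations (t : quotientGrading I 1 ⊗[ℂ] quotientGrading I 1) :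
    t ∈ quadraticRelations (quotientGrading I) ↔
      tensorPoly (varBasis hI) t ∈ Submodule.span ℂ (Set.range fun l => quadric (M l)) := by
  rw [quadraticRelations, LinearMap.mem_ker, lift_mul_eq_mk_tensorPoly hI,
    Ideal.Quotient.eq_zero_iff_mem, mem_iff_of_isHomogeneous hI (tensorPoly_isHomogeneous hI t)]

theorem finiteDimensional_quotientGrading_one : FiniteDimensional ℂ (quotientGrading I 1) :=
  Module.Finite.of_basis (varBasis hI)

/-- All relations between the elements of degree one follow from quadratic ones. -/
theorem mem_span_quadraticRelations (t : TensorAlgebra ℂ (quotientGrading I 1))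
    (ht : TensorAlgebra.lift ℂ (quotientGrading I 1).subtype t = 0) :
    t ∈ TwoSidedIdeal.span (tensorSquare (quotientGrading I 1) ''
      (quadraticRelations (quotientGrading I) :
        Set (quotientGrading I 1 ⊗[ℂ] quotientGrading I 1))) := by
  obtain ⟨G, hG⟩ := exists_hom_of_commutators_mem (varBasis hI) (quadraticRelations (quotientGrading I))
    fun w w' => by
      rw [quadraticRelations, LinearMap.mem_ker, map_sub]
      simp [mul_comm]
  have hGI : ∀ p ∈ I, G p = 0 := by
    intro p hp
    rw [hI] at hp
    induction hp using Submodule.span_induction with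
    | zero => exact map_zero G
    | add a b _ _ ha hb => rw [map_add, ha, hb, add_zero]
    | smul a b _ hb => rw [smul_eq_mul, map_mul, hb, mul_zero]
    | mem p hp =>
      obtain ⟨l, rfl⟩ := hp
      change G (quadric (M l)) = 0
      rw [← tensorPoly_quadricTensor (varBasis hI)]
      exact tensorPoly_eq_zero _ _ G hG (quadricTensor_mem (varBasis hI) (mem_quadraticRelations hI) l)
  -- The projection of the tensor algebra modulo its quadratic relations factors through the
  -- evaluation map to the polynomial quotient, so everything that evaluates to zero lies in the
  -- ideal of relations.
  have hfac : (Ideal.Quotient.liftₐ I G hGI).comp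
      (TensorAlgebra.lift ℂ (quotientGrading I 1).subtype) =
        (TwoSidedIdeal.span (tensorSquare (quotientGrading I 1) ''
          (quadraticRelations (quotientGrading I) :
            Set (quotientGrading I 1 ⊗[ℂ] quotientGrading I 1)))).ringCon.mkₐ ℂ := by
    refine TensorAlgebra.hom_ext ((varBasis hI).ext fun v => ?_)
    simp only [LinearMap.comp_apply, AlgHom.toLinearMap_apply, AlgHom.comp_apply,
      TensorAlgebra.lift_ι_apply, Submodule.subtype_apply, coe_varBasis]
    exact hG v
  have h0 := AlgHom.congr_fun hfac t
  rw [AlgHom.comp_apply, ht, map_zero] at h0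
  exact (RingCon.eq _).1 h0.symm

theorem isQuadratic_quotientGrading : IsQuadratic (quotientGrading I) where
  graded := by
    let _ : GradedAlgebra (homogeneousSubmodule σ ℂ) := MvPolynomial.gradedAlgebra
    refine nonempty_gradedAlgebra ?_
    rw [hI]
    refine Ideal.homogeneous_span _ _ ?_
    rintro _ ⟨l, rfl⟩
    exact ⟨2, quadric_isHomogeneous _⟩
  nontrivial := by
    refine Ideal.Quotient.nontrivial_iff.2 fun h => ?_
    have := homogeneousComponent_eq_zero_of_mem hI (p := 1) (h ▸ Submodule.mem_top) (k := 0)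
      (by norm_num)
    simp at this
  degree_zero := by
    rw [quotientGrading, homogeneousSubmodule_zero]
    exact Submodule.map_one (Ideal.Quotient.mkₐ ℂ I)
  finite := finiteDimensional_quotientGrading_one hI
  generated := by
    have h1 : (Algebra.adjoin ℂ (Set.range (X : σ → MvPolynomial σ ℂ))).map
        (Ideal.Quotient.mkₐ ℂ I) = ⊤ := by
      rw [adjoin_range_X, Algebra.map_top, AlgHom.range_eq_top]
      exact Ideal.Quotient.mkₐ_surjective ℂ I
    rw [AlgHom.map_adjoin] at h1
    refine top_unique (h1.symm.le.trans (Algebra.adjoin_mono ?_))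
    rintro _ ⟨_, ⟨v, rfl⟩, rfl⟩
    exact mk_mem_quotientGrading I (isHomogeneous_X ℂ v)
  relations := mem_span_quadraticRelations hI

/-- The quotient of a polynomial ring by a regular family of quadrics is Koszul. -/
theorem isKoszul_quotientGrading [Fintype ι] (hreg : IsRegularFamily fun l => quadric (M l)) :
    IsKoszul (quotientGrading I) := by
  have hfin := finiteDimensional_quotientGrading_one hI
  obtain ⟨e, he⟩ := exists_dualLie_cohomology_equiv (varBasis hI) (mem_quadraticRelations hI) hreg hI
  refine ⟨isQuadratic_quotientGrading hI, hfin, e, fun w => ?_⟩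
  suffices h : e.toLinearMap ∘ₗ (quotientGrading I 1).subtype =
      classOneLinear (quadraticRelations (quotientGrading I)) from LinearMap.congr_fun h w
  refine (varBasis hI).ext fun v => ?_
  rw [LinearMap.comp_apply, Submodule.subtype_apply, coe_varBasis]
  exact he v

end QuadraticQuotient

/-! ### The relations of the quasimap algebra form a regular family -/

section Relations

open MvPolynomial

variable (n N₁ N₂ : ℕ)

/-- The matrix of the quadratic form `relation n N₁ N₂ l`. -/
def relationMatrix (l : ℤ) : Var n N₁ N₂ → Var n N₁ N₂ → ℂ
  | Sum.inl (i, s), Sum.inr (j, t) => if i = j ∧ (s : ℤ) + t = l then 1 else 0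
  | _, _ => 0

theorem quadric_relationMatrix (l : ℤ) :
    quadric (relationMatrix n N₁ N₂ l) = relation n N₁ N₂ l := by
  simp only [quadric, relation, Fintype.sum_sum_type, Fintype.sum_prod_type, relationMatrix,
    zero_smul, Finset.sum_const_zero, zero_add, add_zero, ite_smul, one_smul]
  rw [Finset.sum_comm]
  refine Finset.sum_congr rfl fun s _ => ?_
  simp only [ite_and, Finset.sum_comm (s := (Finset.univ : Finset (Fin n)))
    (t := (Finset.univ : Finset (Set.Icc (-(N₁ : ℤ)) (N₂ : ℤ))))]
  refine Finset.sum_congr rfl fun t _ => ?_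
  split_ifs with h <;> simp

/-- The relation as a sum over the pairs of variables that occur in it. -/
theorem relation_eq_sum (l : ℤ) : relation n N₁ N₂ l =
    ∑ z ∈ (Finset.univ : Finset (Set.Icc (-(N₁ : ℤ)) (N₂ : ℤ) × Set.Icc (-(N₁ : ℤ)) (N₂ : ℤ) ×
      Fin n)) with (z.1 : ℤ) + z.2.1 = l, X (Sum.inl (z.2.2, z.1)) * X (Sum.inr (z.2.2, z.2.1)) := by
  rw [relation, Finset.sum_filter, Fintype.sum_prod_type]
  refine Finset.sum_congr rfl fun s _ => ?_
  rw [Fintype.sum_prod_type]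
  refine Finset.sum_congr rfl fun t _ => ?_
  split_ifs <;> simp

/-- Weights of the variables for which the product of the variables of index `i` with shifts `s`,
`t` has weight `-(s + t)² - (s - t + [i = 1])² - [i > 1]`. -/
def varWeight : Var n N₁ N₂ → ℤ
  -- Because `(s+t)² + (s-t)² = 2s² + 2t²` and `(s-t+1)² = (s-t)² + 2s - 2t + 1`, the desired weight
  -- has no mixed term in `s` and `t`, so it splits into a left and a right part.
  | Sum.inl (i, s) => -(2 * (s : ℤ) ^ 2 + if (i : ℕ) = 1 then 2 * (s : ℤ) else 0)
  | Sum.inr (i, t) => -(2 * (t : ℤ) ^ 2 - (if (i : ℕ) = 1 then 2 * (t : ℤ) - 1 else 0)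
      + if 1 < (i : ℕ) then 1 else 0)

/-- The weights made nonnegative by a shift. -/
def shiftedWeight (v : Var n N₁ N₂) : ℕ :=
  (varWeight n N₁ N₂ v + ∑ u, |varWeight n N₁ N₂ u|).toNat

theorem coe_shiftedWeight (v : Var n N₁ N₂) : (shiftedWeight n N₁ N₂ v : ℤ) =
    varWeight n N₁ N₂ v + ∑ u, |varWeight n N₁ N₂ u| := by
  refine Int.toNat_of_nonneg ?_
  have h1 := Finset.single_le_sum (f := fun u => |varWeight n N₁ N₂ u|) (fun u _ => abs_nonneg _)
    (Finset.mem_univ v)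
  have h2 := neg_abs_le (varWeight n N₁ N₂ v)
  linarith

variable {n N₁ N₂}

/-- The index of the leading term of a relation. -/
def leadIndex (hn : 3 ≤ n) (l : ℤ) : Fin n :=
  -- The square `(s-t+[i=1])²` can vanish with `s+t = l` only for `i = 0` or `i > 1` if `l` is even,
  -- and only for `i = 1` if `l` is odd; the penalty `[i>1]` leaves one index.
  if l % 2 = 0 then ⟨0, by omega⟩ else ⟨1, by omega⟩

/-- The left factor of the leading term of a relation. -/
def leadLeft (hn : 3 ≤ n) (l : Set.Icc (-2 * (N₁ : ℤ)) (2 * (N₂ : ℤ))) : Var n N₁ N₂ :=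
  Sum.inl (leadIndex hn l, ⟨(l : ℤ) / 2, by have := l.2.1; have := l.2.2; constructor <;> omega⟩)

/-- The right factor of the leading term of a relation. -/
def leadRight (hn : 3 ≤ n) (l : Set.Icc (-2 * (N₁ : ℤ)) (2 * (N₂ : ℤ))) : Var n N₁ N₂ :=
  Sum.inr (leadIndex hn l, ⟨(l : ℤ) - l / 2, by have := l.2.1; have := l.2.2; constructor <;> omega⟩)

theorem leadIndex_eq_iff (hn : 3 ≤ n) (l m : ℤ) :
    leadIndex hn l = leadIndex hn m ↔ l % 2 = m % 2 := by
  unfold leadIndex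
  split_ifs with h1 h2 h2 <;> simp [Fin.ext_iff] <;> omega

/-- The index of the variable records the parity of `l` and its shift records `⌊l/2⌋`; together they
determine `l`. -/
theorem leadLeft_injective (hn : 3 ≤ n) : Function.Injective (leadLeft (N₁ := N₁) (N₂ := N₂) hn) := by
  intro l m h
  simp only [leadLeft, Sum.inl.injEq, Prod.mk.injEq, leadIndex_eq_iff, Subtype.ext_iff] at h
  exact Subtype.ext (by omega)

theorem leadRight_injective (hn : 3 ≤ n) :
    Function.Injective (leadRight (N₁ := N₁) (N₂ := N₂) hn) := by
  intro l m h
  simp only [leadRight, Sum.inr.injEq, Prod.mk.injEq, leadIndex_eq_iff, Subtype.ext_iff] at h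
  exact Subtype.ext (by omega)

theorem varWeight_add (i : Fin n) (s t : Set.Icc (-(N₁ : ℤ)) (N₂ : ℤ)) :
    varWeight n N₁ N₂ (Sum.inl (i, s)) + varWeight n N₁ N₂ (Sum.inr (i, t)) =
      -((s : ℤ) + t) ^ 2 - ((s : ℤ) - t + if (i : ℕ) = 1 then 1 else 0) ^ 2 -
        if 1 < (i : ℕ) then 1 else 0 := by
  simp only [varWeight]
  split_ifs <;> ring

theorem varWeight_lead (hn : 3 ≤ n) (l : Set.Icc (-2 * (N₁ : ℤ)) (2 * (N₂ : ℤ))) :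
    varWeight n N₁ N₂ (leadLeft hn l) + varWeight n N₁ N₂ (leadRight hn l) = -(l : ℤ) ^ 2 := by
  rw [leadLeft, leadRight, varWeight_add]
  simp only [leadIndex]
  split_ifs with h1 h2 h3 h4 <;> simp_all <;> omega

/-- The value `-l²` is reached only for `i ≤ 1` and `s - t + [i=1] = 0`. With `s + t = l` this fixes
`i` by parity and then `s` and `t`, which is the leading term. -/
theorem varWeight_lt (hn : 3 ≤ n) (l : Set.Icc (-2 * (N₁ : ℤ)) (2 * (N₂ : ℤ))) (i : Fin n)
    (s t : Set.Icc (-(N₁ : ℤ)) (N₂ : ℤ)) (h : (s : ℤ) + t = l)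
    (hne : ¬ (leadLeft hn l = Sum.inl (i, s) ∧ leadRight hn l = Sum.inr (i, t))) :
    varWeight n N₁ N₂ (Sum.inl (i, s)) + varWeight n N₁ N₂ (Sum.inr (i, t)) < -(l : ℤ) ^ 2 := by
  rw [varWeight_add, h]
  by_cases h1 : 1 < (i : ℕ)
  · rw [if_pos h1]
    nlinarith [sq_nonneg ((s : ℤ) - t + if (i : ℕ) = 1 then 1 else 0)]
  rw [if_neg h1]
  suffices h2 : (s : ℤ) - t + (if (i : ℕ) = 1 then 1 else 0) ≠ 0 by
    have := pow_pos (abs_pos.2 h2) 2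
    rw [sq_abs] at this
    linarith
  intro h0
  apply hne
  simp only [leadLeft, leadRight, Sum.inl.injEq, Sum.inr.injEq, Prod.mk.injEq, Subtype.ext_iff,
    leadIndex, Fin.ext_iff]
  split_ifs at h0 with h3
  · rw [if_neg (by omega)]
    simp only
    omega
  · rw [if_pos (by omega)]
    simp only
    omega

theorem isRegularFamily_relation (hn : 3 ≤ n) :
    IsRegularFamily fun l : Set.Icc (-2 * (N₁ : ℤ)) (2 * (N₂ : ℤ)) =>
      quadric (relationMatrix n N₁ N₂ l) := by
  refine isRegularFamily_of_hasLead (w := shiftedWeight n N₁ N₂) (a := leadLeft hn)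
    (b := leadRight hn) (leadLeft_injective hn) (leadRight_injective hn)
    (fun i j => Sum.inl_ne_inr) fun l => ?_
  have hw (u v : Var n N₁ N₂) : Finsupp.weight (shiftedWeight n N₁ N₂)
      (Finsupp.single u 1 + Finsupp.single v 1) = shiftedWeight n N₁ N₂ u + shiftedWeight n N₁ N₂ v := by
    simp [Finsupp.weight_single]
  have hX (u v : Var n N₁ N₂) : (X u * X v : MvPolynomial (Var n N₁ N₂) ℂ) =
      monomial (Finsupp.single u 1 + Finsupp.single v 1) 1 := by
    simp [X, monomial_mul]
  rw [HasLead, quadric_relationMatrix, relation_eq_sum, pairExp, ← hX, hw]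
  have hmem : ((⟨(l : ℤ) / 2, by have := l.2.1; have := l.2.2; constructor <;> omega⟩,
      ⟨(l : ℤ) - l / 2, by have := l.2.1; have := l.2.2; constructor <;> omega⟩,
      leadIndex hn l) : Set.Icc (-(N₁ : ℤ)) (N₂ : ℤ) × Set.Icc (-(N₁ : ℤ)) (N₂ : ℤ) × Fin n) ∈
      ({z | (z.1 : ℤ) + z.2.1 = l} : Finset (Set.Icc (-(N₁ : ℤ)) (N₂ : ℤ) ×
        Set.Icc (-(N₁ : ℤ)) (N₂ : ℤ) × Fin n)) := by
    simp
  rw [← Finset.add_sum_erase _ _ hmem, leadLeft, leadRight, add_sub_cancel_left]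
  refine Submodule.sum_mem _ fun ⟨s, t, i⟩ hz => ?_
  obtain ⟨hne, hst⟩ := Finset.mem_erase.1 hz
  replace hst : (s : ℤ) + t = l := (Finset.mem_filter.1 hst).2
  rw [hX]
  refine monomial_mem_weightLT ?_ 1
  rw [hw]
  -- Both monomials have degree two, so the constant shift of the weights cancels.
  zify
  simp only [coe_shiftedWeight]
  have h1 := varWeight_lead hn l
  have h2 := varWeight_lt hn l i s t hst (by
    rintro ⟨e1, e2⟩
    apply hne
    simp only [leadLeft, leadRight, Sum.inl.injEq, Sum.inr.injEq, Prod.mk.injEq] at e1 e2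
    rw [← e1.2, ← e2.2, ← e1.1])
  rw [leadLeft, leadRight] at h1
  linarith

end Relations

end QuasimapKoszul

end

theorem mainTheorem3 (n N₁ N₂ : ℕ) (hn : 3 ≤ n) :
    QuasimapKoszul.IsKoszul (QuasimapKoszul.quasimapGrading n N₁ N₂) := by
  -- The grading `quasimapGrading` is by definition `quotientGrading` of `relationIdeal`; what
  -- remains is that this ideal is generated by the family of quadrics.
  refine QuasimapKoszul.isKoszul_quotientGrading
    (M := fun l : Set.Icc (-2 * (N₁ : ℤ)) (2 * (N₂ : ℤ)) =>
      QuasimapKoszul.relationMatrix n N₁ N₂ l)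
    (I := QuasimapKoszul.relationIdeal n N₁ N₂) ?_
    (QuasimapKoszul.isRegularFamily_relation hn)
  rw [QuasimapKoszul.relationIdeal, Set.image_eq_range]
  simp only [QuasimapKoszul.quadric_relationMatrix]
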